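/- Let $\mathbb H\cong\mathbb R^4$ be the quaternions with their usual scalar product $\langle\cdot,\cdot\rangle$. A rank-4 lattice is an additive subgroup $L\subset\mathbb H$ generated by four $\mathbb R$-linearly independent elements; such an (ordered) 4-tuple of generators is a basis of $L$, and the Gram matrix of a basis $(v_1,\dots,v_4)$ is $(\langle v_i,v_j\rangle)_{i,j}$. A Gram matrix $R$ is called reduced if $R=U S_0\,{}^tU$, where $S_0$ is the Gram matrix of a basis of some rank-4 lattice and $U\in GL(4,\mathbb Z)$, with rows $u_1,\dots,u_4$, is an output of the Minkowski–Siegel reduction algorithm applied to $S_0$: $u_1$ minimizes $u S_0\,{}^tu$ among the non-zero $u\in\mathbb Z^4$; for $k=2,3,4$, $u_k$ minimizes $u S_0\,{}^tu$ among those $u\in\mathbb Z^4$ for which some matrix in $GL(4,\mathbb Z)$ has first $k$ rows $u_1,\dots,u_{k-1},u$; and $u_k S_0\,{}^tu_{k+1}\ge 0$ for $k=1,2,3$. Let $\mathcal R$ be the set of all reduced Gram matrices, viewed as a subset of the space $\mathbb R^{10}$ of real symmetric $4\times4$ matrices. A basis of $L$ is reduced if its Gram matrix lies in $\mathcal R$,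 and $L$ is tame if it has a reduced basis whose Gram matrix is an interior point of $\mathcal R$. A function $f:\Omega\to\mathbb H$ on an open set $\Omega\subset\mathbb H$ is slice regular if, for every $I\in\mathbb H$ with $I^2=-1$, the restriction $f_I$ of $f$ to $\Omega\cap(\mathbb R+I\mathbb R)$ is continuously differentiable and $\frac12\left(\frac{\partial}{\partial x}+I\frac{\partial}{\partial y}\right)f_I(x+Iy)=0$ there. The torus $\mathbb H/L$ carries the atlas of local inverses of the projection $\mathbb H\to\mathbb H/L$. Two tori $\mathbb H/L_1$, $\mathbb H/L_2$ are equivalent if there is a diffeomorphism between them which, together with its inverse, is slice regular in the charts of these atlases. A torus $\mathbb H/L$ is tame if it is equivalent to $\mathbb H/L'$ for some tame rank-4 lattice $L'$. **Proposition.** Let $L$ be a rank-4 lattice in $\mathbb H$ and let $\mathcal B=(v_1,v_2,v_3,v_4)$ be a reduced basis of $L$. Then the torus $\mathbb H/L$ is tame if and only if $\mathcal B$ and $-\mathcal B=(-v_1,-v_2,-v_3,-v_4)$ are the only reduced bases of $L$. -/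

import Mathlib

open scoped Quaternion Matrix ContDiff

namespace QTorus

noncomputable section

/-! ### Slice regular functions -/

/-- Slice regularity of `f` on an open set `Ω` of quaternions: for each imaginary unit `I`, the
restriction of `f` to the slice `ℝ + ℝ I`, read in the coordinates `(x, y) ↦ x + y I`, is
continuously differentiable and satisfies `(1/2) (∂/∂x + I ∂/∂y) f = 0`. -/
def IsSliceRegularOn (f : ℍ[ℝ] → ℍ[ℝ]) (Ω : Set ℍ[ℝ]) : Prop :=
  ∀ I : ℍ[ℝ], I ^ 2 = -1 →
    let g : ℝ × ℝ → ℍ[ℝ] := fun p => f ((p.1 : ℍ[ℝ]) + p.2 • I)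
    let ΩI : Set (ℝ × ℝ) := {p | (p.1 : ℍ[ℝ]) + p.2 • I ∈ Ω}
    ContDiffOn ℝ 1 g ΩI ∧
      ∀ p ∈ ΩI, (1 / 2 : ℝ) • (fderiv ℝ g p (1, 0) + I * fderiv ℝ g p (0, 1)) = 0

/-! ### Lattices and quaternionic tori -/

/-- `v` is an (ordered) basis of the rank-4 lattice `L`. -/
def IsLatticeBasis (v : Fin 4 → ℍ[ℝ]) (L : AddSubgroup ℍ[ℝ]) : Prop :=
  LinearIndependent ℝ v ∧ AddSubgroup.closure (Set.range v) = L

/-- `L` is a rank-4 lattice: it is generated by four real-linearly independent quaternions. -/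
def IsLattice (L : AddSubgroup ℍ[ℝ]) : Prop := ∃ v, IsLatticeBasis v L

/-- The atlas of the torus `ℍ / L`: its charts are the inverses of the canonical projection
restricted to open sets on which it is a homeomorphism onto an open image. -/
def torusAtlas (L : AddSubgroup ℍ[ℝ]) : Set (OpenPartialHomeomorph (ℍ[ℝ] ⧸ L) ℍ[ℝ]) :=
  {φ | ∀ q ∈ φ.target, φ.symm q = (q : ℍ[ℝ] ⧸ L)}

/-- A regular map of tori: continuous, and slice regular in all charts of the two atlases. -/
def IsRegularMap {L₁ L₂ : AddSubgroup ℍ[ℝ]} (f : ℍ[ℝ] ⧸ L₁ → ℍ[ℝ] ⧸ L₂) : Prop :=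
  Continuous f ∧ ∀ φ ∈ torusAtlas L₁, ∀ ψ ∈ torusAtlas L₂,
    IsSliceRegularOn (ψ ∘ f ∘ φ.symm) (φ.target ∩ φ.symm ⁻¹' (f ⁻¹' ψ.source))

/-- A smooth map of tori: continuous, and smooth (over `ℝ`) in all charts of the two atlases. -/
def IsSmoothMap {L₁ L₂ : AddSubgroup ℍ[ℝ]} (f : ℍ[ℝ] ⧸ L₁ → ℍ[ℝ] ⧸ L₂) : Prop :=
  Continuous f ∧ ∀ φ ∈ torusAtlas L₁, ∀ ψ ∈ torusAtlas L₂,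
    ContDiffOn ℝ ∞ (ψ ∘ f ∘ φ.symm) (φ.target ∩ φ.symm ⁻¹' (f ⁻¹' ψ.source))

/-- A biregular diffeomorphism: a diffeomorphism which is regular together with its inverse. -/
def IsBiregularDiffeo {L₁ L₂ : AddSubgroup ℍ[ℝ]} (f : (ℍ[ℝ] ⧸ L₁) ≃ (ℍ[ℝ] ⧸ L₂)) : Prop :=
  IsSmoothMap f ∧ IsSmoothMap f.symm ∧ IsRegularMap f ∧ IsRegularMap f.symm

/-- The tori `ℍ / L₁` and `ℍ / L₂` are equivalent. -/
def EquivalentTori (L₁ L₂ : AddSubgroup ℍ[ℝ]) : Prop :=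
  ∃ f : (ℍ[ℝ] ⧸ L₁) ≃ (ℍ[ℝ] ⧸ L₂), IsBiregularDiffeo f

/-! ### Reduced Gram matrices and reduced bases -/

/-- The space `ℝ¹⁰` of real symmetric `4 × 4` matrices, with the topology of the entries. -/
abbrev SymMat : Type := {S : Matrix (Fin 4) (Fin 4) ℝ // S.IsSymm}

/-- The Gram matrix `⟨v i, v j⟩` of four quaternions, for the usual scalar product of `ℝ⁴`. -/
def gramMatrix (v : Fin 4 → ℍ[ℝ]) : SymMat :=
  ⟨Matrix.of fun i j => inner ℝ (v i) (v j),
    Matrix.IsSymm.ext fun i j => real_inner_comm (v i) (v j)⟩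

/-- The value `u S ᵗw` for integer row vectors `u`, `w`. -/
def rowForm (S : Matrix (Fin 4) (Fin 4) ℝ) (u w : Fin 4 → ℤ) : ℝ :=
  (fun i => (u i : ℝ)) ⬝ᵥ (S *ᵥ fun i => (w i : ℝ))

/-- There is a matrix of `GL(4, ℤ)` whose first rows are the rows of `U` of index `< k`,
followed by `u`. -/
def Completable (U : Matrix (Fin 4) (Fin 4) ℤ) (k : Fin 4) (u : Fin 4 → ℤ) : Prop :=
  ∃ V : Matrix (Fin 4) (Fin 4) ℤ, IsUnit V.det ∧ (∀ j < k, V j = U j) ∧ V k = u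

/-- `U` is a possible output of the Minkowski-Siegel Reduction Algorithm applied to `S`: its first
row minimizes `u S ᵗu` among the non-zero integer vectors, each of the next rows minimizes
`u S ᵗu` among the vectors that complete the previous rows to (the first rows of) a matrix of
`GL(4, ℤ)`, and the signs are such that consecutive rows have non-negative product. -/
structure IsReductionOutput (S : Matrix (Fin 4) (Fin 4) ℝ) (U : Matrix (Fin 4) (Fin 4) ℤ) :
    Prop where
  isUnit_det : IsUnit U.det
  first_min : ∀ u : Fin 4 → ℤ, u ≠ 0 → rowForm S (U 0) (U 0) ≤ rowForm S u u
  next_min : ∀ k : Fin 4, k ≠ 0 → ∀ u : Fin 4 → ℤ, Completable U k u →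
    rowForm S (U k) (U k) ≤ rowForm S u u
  sign : ∀ k : Fin 3, 0 ≤ rowForm S (U k.castSucc) (U k.succ)

/-- The set of all reduced Gram matrices: the matrices `U S₀ ᵗU`, where `S₀` is the Gram matrix of
a basis and `U` is produced by the algorithm applied to `S₀`. -/
def reducedGram : Set SymMat :=
  {R | ∃ (v : Fin 4 → ℍ[ℝ]) (U : Matrix (Fin 4) (Fin 4) ℤ), LinearIndependent ℝ v ∧
    IsReductionOutput (gramMatrix v).1 U ∧
    R.1 = U.map (Int.cast : ℤ → ℝ) * (gramMatrix v).1 * (U.map (Int.cast : ℤ → ℝ))ᵀ}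

/-- A reduced basis of `L`: a basis of `L` whose Gram matrix is reduced. -/
def IsReducedBasis (v : Fin 4 → ℍ[ℝ]) (L : AddSubgroup ℍ[ℝ]) : Prop :=
  IsLatticeBasis v L ∧ gramMatrix v ∈ reducedGram

/-! ### Tameness -/

/-- A tame lattice: a rank-4 lattice having a reduced basis whose Gram matrix is an interior point
of the set of reduced Gram matrices (inside the space of symmetric matrices). -/
def IsTameLattice (L : AddSubgroup ℍ[ℝ]) : Prop :=
  ∃ v, IsReducedBasis v L ∧ gramMatrix v ∈ interior reducedGram

/-- The torus `ℍ / L` is tame: it is equivalent to `ℍ / L'` for some tame lattice `L'`. -/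
def IsTameTorus (L : AddSubgroup ℍ[ℝ]) : Prop :=
  ∃ L' : AddSubgroup ℍ[ℝ], IsTameLattice L' ∧ EquivalentTori L L'

end

end QTorus

namespace QTorus

noncomputable section

/-! ### Lattices -/

/-! Two facts carry the proof, one on tori and one on Gram matrices. Tori: an equivalence `ℍ/L₁ →
ℍ/L₂` lifts to a smooth, slice regular map `F` on `ℍ`. Its derivative in the real direction is
`L₁`-periodic, hence bounded. On each slice it is made of derivatives of entire functions, so
Liouville makes it constant. All slices share the real axis, so the constant `a` is the same for
all, and `F q = F 0 + q * a` (`eq_affine_of_regular`). Thus `L₁ * a = L₂` with `a ≠ 0`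
(`EquivalentTori.exists_mul`). Right multiplication by `a` scales Gram matrices by `‖a‖²`, so it
matches the reduced bases of the two lattices, and uniqueness up to sign passes from `L₂` to `L₁`.
Gram matrices: for a reduced `R`, three conditions agree: `R` is interior to `reducedGram`; the
reduction inequalities are strict except for `±eₖ` (`IsStrictlyReduced`); the algorithm applied to
`R` outputs only `±1`. Perturbing entries shows that interior points are strict. Strictness forces
the rows of an output one by one. Conversely, a tie would extend to a second output. Strictness is
open because, by coercivity, only finitely many inequalities matter near `R`. -/

/-- A lattice basis as a basis of the real vector space of quaternions. -/
def realBasis {v : Fin 4 → ℍ[ℝ]} (hv : LinearIndependent ℝ v) : Module.Basis (Fin 4) ℝ ℍ[ℝ] :=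
  basisOfLinearIndependentOfCardEqFinrank hv (by simp [Quaternion.finrank_eq_four])

theorem coe_realBasis {v : Fin 4 → ℍ[ℝ]} (hv : LinearIndependent ℝ v) : ⇑(realBasis hv) = v := by
  simp [realBasis]

theorem IsLatticeBasis.span_eq {v : Fin 4 → ℍ[ℝ]} {L : AddSubgroup ℍ[ℝ]}
    (hv : IsLatticeBasis v L) :
    (Submodule.span ℤ (Set.range (realBasis hv.1))).toAddSubgroup = L := by
  rw [Submodule.span_int_eq_addSubgroupClosure, coe_realBasis, hv.2]

theorem IsLattice.isDiscrete {L : AddSubgroup ℍ[ℝ]} (hL : IsLattice L) :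
    IsDiscrete (L : Set ℍ[ℝ]) := by
  obtain ⟨v, hv⟩ := hL
  rw [← hv.span_eq]
  exact ⟨inferInstanceAs
    (DiscreteTopology (Submodule.span ℤ (Set.range (realBasis hv.1))))⟩

/-- Supplies both the charts of the torus and the lifting of maps between tori. -/
theorem IsLattice.isCoveringMap {L : AddSubgroup ℍ[ℝ]} (hL : IsLattice L) :
    IsCoveringMap (QuotientAddGroup.mk : ℍ[ℝ] → ℍ[ℝ] ⧸ L) :=
  (L.isAddQuotientCoveringMap hL.isDiscrete).isCoveringMap

/-- Every quaternion is congruent modulo a lattice to one of bounded norm. -/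
theorem IsLattice.exists_bounded_rep {L : AddSubgroup ℍ[ℝ]} (hL : IsLattice L) :
    ∃ C : ℝ, ∀ q : ℍ[ℝ], ∃ l ∈ L, ‖q - l‖ ≤ C := by
  obtain ⟨v, hv⟩ := hL
  refine ⟨∑ i, ‖realBasis hv.1 i‖, fun q => ⟨ZSpan.floor (realBasis hv.1) q, ?_, ?_⟩⟩
  · have h := (ZSpan.floor (realBasis hv.1) q).2
    exact hv.span_eq.le h
  · have := ZSpan.norm_fract_le (K := ℝ) (realBasis hv.1) q
    rwa [ZSpan.fract_apply] at this

/-- A continuous map with values in a lattice is constant on quaternions. -/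
theorem IsLattice.eq_of_continuous {L : AddSubgroup ℍ[ℝ]} (hL : IsLattice L) {d : ℍ[ℝ] → ℍ[ℝ]}
    (hd : Continuous d) (hdL : ∀ q, d q ∈ L) (x y : ℍ[ℝ]) : d x = d y := by
  have : DiscreteTopology L := hL.isDiscrete.to_subtype
  have h := isPreconnected_univ.constant (f := fun q => (⟨d q, hdL q⟩ : L))
    (by fun_prop) (Set.mem_univ x) (Set.mem_univ y)
  exact congrArg Subtype.val h

/-- Otherwise the identity would be a continuous map into `L`, hence constant. This later excludes
the multiplier `a = 0`. -/
theorem IsLattice.ne_top {L : AddSubgroup ℍ[ℝ]} (hL : IsLattice L) : L ≠ ⊤ := by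
  rintro rfl
  exact zero_ne_one (hL.eq_of_continuous continuous_id (fun _ => AddSubgroup.mem_top _) 0 1)

/-- Around each quaternion the projection to the torus has a local inverse. -/
theorem IsLattice.exists_chart {L : AddSubgroup ℍ[ℝ]} (hL : IsLattice L) (q : ℍ[ℝ]) :
    ∃ φ ∈ torusAtlas L, q ∈ φ.target := by
  obtain ⟨e, hq, he⟩ := hL.isCoveringMap.isLocalHomeomorph q
  exact ⟨e.symm, fun x _ => by rw [OpenPartialHomeomorph.symm_symm, ← he], hq⟩

theorem chart_apply_mk {L : AddSubgroup ℍ[ℝ]} {φ : OpenPartialHomeomorph (ℍ[ℝ] ⧸ L) ℍ[ℝ]}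
    (hφ : φ ∈ torusAtlas L) {q : ℍ[ℝ]} (hq : q ∈ φ.target) : φ (q : ℍ[ℝ] ⧸ L) = q := by
  rw [← hφ q hq, φ.right_inv hq]

/-! ### The identity is biregular -/

/-- The transition map between two charts is locally a translation. -/
theorem transition_eventuallyEq {L : AddSubgroup ℍ[ℝ]} (hL : IsLattice L)
    {φ ψ : OpenPartialHomeomorph (ℍ[ℝ] ⧸ L) ℍ[ℝ]} (hφ : φ ∈ torusAtlas L) (hψ : ψ ∈ torusAtlas L)
    {q : ℍ[ℝ]} (hq : q ∈ φ.target ∩ φ.symm ⁻¹' (id ⁻¹' ψ.source)) :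
    ∃ c : ℍ[ℝ], ψ ∘ id ∘ φ.symm =ᶠ[nhds q] fun x => x + c := by
  have hopen : IsOpen (φ.target ∩ φ.symm ⁻¹' ψ.source) := φ.isOpen_inter_preimage_symm ψ.open_source
  have hcont : ContinuousOn (fun x => ψ (φ.symm x) - x) (φ.target ∩ φ.symm ⁻¹' ψ.source) :=
    (ψ.continuousOn.comp (φ.symm.continuousOn.mono Set.inter_subset_left)
      fun x hx => hx.2).sub continuousOn_id
  have hmem : ∀ x ∈ φ.target ∩ φ.symm ⁻¹' ψ.source, ψ (φ.symm x) - x ∈ L := by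
    intro x hx
    have h1 : ((ψ (φ.symm x) : ℍ[ℝ]) : ℍ[ℝ] ⧸ L) = (x : ℍ[ℝ] ⧸ L) := by
      rw [← hψ _ (ψ.map_source hx.2), ψ.left_inv hx.2, hφ _ hx.1]
    have := QuotientAddGroup.eq.1 h1.symm
    rwa [neg_add_eq_sub] at this
  refine ⟨ψ (φ.symm q) - q, ?_⟩
  have : DiscreteTopology L := hL.isDiscrete.to_subtype
  obtain ⟨r, hr, hball⟩ := Metric.isOpen_iff.1 hopen q hq
  -- On a ball, which is connected, the `L`-valued difference `ψ (φ.symm x) - x` is constant.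
  filter_upwards [Metric.ball_mem_nhds q hr] with x hx
  have hc : Continuous fun y : Metric.ball q r =>
      (⟨ψ (φ.symm y) - y, hmem _ (hball y.2)⟩ : L) :=
    Continuous.subtype_mk (continuousOn_iff_continuous_domRestrict.1 (hcont.mono hball)) _
  have : PreconnectedSpace (Metric.ball q r) :=
    Subtype.preconnectedSpace (convex_ball q r).isPreconnected
  have h := isPreconnected_univ.constant hc.continuousOn (Set.mem_univ ⟨x, hx⟩)
    (Set.mem_univ ⟨q, Metric.mem_ball_self hr⟩)
  have h' := congrArg Subtype.val h
  simp only at h'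
  simp [← h']

theorem isSmoothMap_id {L : AddSubgroup ℍ[ℝ]} (hL : IsLattice L) :
    IsSmoothMap (id : ℍ[ℝ] ⧸ L → ℍ[ℝ] ⧸ L) := by
  refine ⟨continuous_id, fun φ hφ ψ hψ q hq => ?_⟩
  obtain ⟨c, hc⟩ := transition_eventuallyEq hL hφ hψ hq
  exact ((contDiff_id.add contDiff_const).contDiffAt.congr_of_eventuallyEq hc).contDiffWithinAt

/-- The slice through the imaginary unit `I` as a continuous linear map. -/
def sliceCLM (I : ℍ[ℝ]) : ℝ × ℝ →L[ℝ] ℍ[ℝ] :=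
  (ContinuousLinearMap.fst ℝ ℝ ℝ).smulRight 1 + (ContinuousLinearMap.snd ℝ ℝ ℝ).smulRight I

theorem sliceCLM_apply (I : ℍ[ℝ]) (p : ℝ × ℝ) : sliceCLM I p = (p.1 : ℍ[ℝ]) + p.2 • I := by
  simp [sliceCLM, ← Algebra.algebraMap_eq_smul_one, Quaternion.algebraMap_def]

theorem isRegularMap_id {L : AddSubgroup ℍ[ℝ]} (hL : IsLattice L) :
    IsRegularMap (id : ℍ[ℝ] ⧸ L → ℍ[ℝ] ⧸ L) := by
  refine ⟨continuous_id, fun φ hφ ψ hψ I hI => ?_⟩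
  simp only [← sliceCLM_apply]
  have key : ∀ p : ℝ × ℝ, sliceCLM I p ∈ φ.target ∩ φ.symm ⁻¹' (id ⁻¹' ψ.source) →
      ∃ c : ℍ[ℝ], (fun p => (ψ ∘ id ∘ φ.symm) (sliceCLM I p)) =ᶠ[nhds p]
        fun p => sliceCLM I p + c := by
    intro p hp
    obtain ⟨c, hc⟩ := transition_eventuallyEq hL hφ hψ hp
    exact ⟨c, (sliceCLM I).continuous.continuousAt.eventually hc⟩
  refine ⟨fun p hp => ?_, fun p hp => ?_⟩
  · obtain ⟨c, hc⟩ := key p hp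
    exact (((sliceCLM I).contDiff.add contDiff_const).contDiffAt.congr_of_eventuallyEq
      hc).contDiffWithinAt
  · obtain ⟨c, hc⟩ := key p hp
    rw [hc.fderiv_eq, fderiv_add_const, ContinuousLinearMap.fderiv, sliceCLM_apply,
      sliceCLM_apply]
    -- The Cauchy-Riemann expression of a translated slice is `1 + I * I = 0`.
    simp [← pow_two, hI]

theorem equivalentTori_refl {L : AddSubgroup ℍ[ℝ]} (hL : IsLattice L) : EquivalentTori L L :=
  ⟨Equiv.refl _, isSmoothMap_id hL, isSmoothMap_id hL, isRegularMap_id hL, isRegularMap_id hL⟩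

/-! ### Lifting a biregular map -/

/-- `ℍ` is simply connected, so the composite of `f` with the projection lifts through the covering
`ℍ → ℍ/L₂`. -/
theorem IsLattice.exists_lift {L₁ L₂ : AddSubgroup ℍ[ℝ]} (hL₂ : IsLattice L₂)
    {f : ℍ[ℝ] ⧸ L₁ → ℍ[ℝ] ⧸ L₂} (hf : Continuous f) :
    ∃ F : ℍ[ℝ] → ℍ[ℝ], Continuous F ∧ ∀ q : ℍ[ℝ], (F q : ℍ[ℝ] ⧸ L₂) = f q := by
  obtain ⟨e₀, he₀⟩ := QuotientAddGroup.mk_surjective (f ((0 : ℍ[ℝ]) : ℍ[ℝ] ⧸ L₁))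
  obtain ⟨F, ⟨-, hF⟩, -⟩ := hL₂.isCoveringMap.existsUnique_continuousMap_lifts
    ⟨fun q : ℍ[ℝ] => f q, hf.comp continuous_quot_mk⟩ 0 e₀ he₀
  exact ⟨F, F.continuous, fun q => congrFun hF q⟩

/-- A lift of a map of tori agrees locally with the expression of the map in charts. -/
theorem lift_eventuallyEq {L₁ L₂ : AddSubgroup ℍ[ℝ]} {f : ℍ[ℝ] ⧸ L₁ → ℍ[ℝ] ⧸ L₂}
    {F : ℍ[ℝ] → ℍ[ℝ]} (hF : Continuous F) (hFf : ∀ q : ℍ[ℝ], (F q : ℍ[ℝ] ⧸ L₂) = f q)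
    {φ : OpenPartialHomeomorph (ℍ[ℝ] ⧸ L₁) ℍ[ℝ]} (hφ : φ ∈ torusAtlas L₁)
    {ψ : OpenPartialHomeomorph (ℍ[ℝ] ⧸ L₂) ℍ[ℝ]} (hψ : ψ ∈ torusAtlas L₂)
    {q : ℍ[ℝ]} (hq : q ∈ φ.target) (hFq : F q ∈ ψ.target) :
    F =ᶠ[nhds q] ψ ∘ f ∘ φ.symm ∧
      φ.target ∩ φ.symm ⁻¹' (f ⁻¹' ψ.source) ∈ nhds q := by
  have h : ∀ᶠ x in nhds q, x ∈ φ.target ∧ F x ∈ ψ.target :=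
    (φ.open_target.eventually_mem hq).and
      (hF.continuousAt.eventually (ψ.open_target.eventually_mem hFq))
  constructor
  · filter_upwards [h] with x hx
    simp only [Function.comp_apply]
    rw [hφ x hx.1, ← hFf, chart_apply_mk hψ hx.2]
  · filter_upwards [h] with x hx
    refine ⟨hx.1, ?_⟩
    simp only [Set.mem_preimage]
    rw [hφ x hx.1, ← hFf, ← hψ _ hx.2]
    exact ψ.map_target hx.2

theorem IsSmoothMap.contDiff_lift {L₁ L₂ : AddSubgroup ℍ[ℝ]} (hL₁ : IsLattice L₁)
    (hL₂ : IsLattice L₂) {f : ℍ[ℝ] ⧸ L₁ → ℍ[ℝ] ⧸ L₂} (hf : IsSmoothMap f)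
    {F : ℍ[ℝ] → ℍ[ℝ]} (hF : Continuous F) (hFf : ∀ q : ℍ[ℝ], (F q : ℍ[ℝ] ⧸ L₂) = f q) :
    ContDiff ℝ ∞ F := by
  rw [contDiff_iff_contDiffAt]
  intro q
  obtain ⟨φ, hφ, hq⟩ := hL₁.exists_chart q
  obtain ⟨ψ, hψ, hFq⟩ := hL₂.exists_chart (F q)
  obtain ⟨h1, h2⟩ := lift_eventuallyEq hF hFf hφ hψ hq hFq
  exact ((hf.2 φ hφ ψ hψ).contDiffAt h2).congr_of_eventuallyEq h1

/-- In charts the lift coincides locally with `f`. The chain rule along the slice turns regularity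
into `dF(1) + I * dF(I) = 0`, and left multiplication by `I` solves for `dF(I)`. -/
theorem IsRegularMap.fderiv_lift {L₁ L₂ : AddSubgroup ℍ[ℝ]} (hL₁ : IsLattice L₁)
    (hL₂ : IsLattice L₂) {f : ℍ[ℝ] ⧸ L₁ → ℍ[ℝ] ⧸ L₂} (hf : IsRegularMap f)
    {F : ℍ[ℝ] → ℍ[ℝ]} (hF : ContDiff ℝ ∞ F) (hFf : ∀ q : ℍ[ℝ], (F q : ℍ[ℝ] ⧸ L₂) = f q)
    {I : ℍ[ℝ]} (hI : I ^ 2 = -1) (p : ℝ × ℝ) :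
    fderiv ℝ F (sliceCLM I p) I = I * fderiv ℝ F (sliceCLM I p) 1 := by
  obtain ⟨φ, hφ, hq⟩ := hL₁.exists_chart (sliceCLM I p)
  obtain ⟨ψ, hψ, hFq⟩ := hL₂.exists_chart (F (sliceCLM I p))
  obtain ⟨h1, h2⟩ := lift_eventuallyEq hF.continuous hFf hφ hψ hq hFq
  have h := ((hf.2 φ hφ ψ hψ) I hI).2 p (by
    have := mem_of_mem_nhds h2
    rw [sliceCLM_apply] at this
    exact this)
  simp only [← sliceCLM_apply] at h
  have h3 : (fun p => (ψ ∘ f ∘ φ.symm) (sliceCLM I p)) =ᶠ[nhds p] F ∘ sliceCLM I :=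
    (sliceCLM I).continuous.continuousAt.eventually h1.symm
  have hd : DifferentiableAt ℝ F (sliceCLM I p) := (hF.differentiable (by simp)).differentiableAt
  rw [h3.fderiv_eq, fderiv_comp _ hd (sliceCLM I).differentiableAt,
    ContinuousLinearMap.fderiv] at h
  simp only [ContinuousLinearMap.comp_apply, sliceCLM_apply I (1, 0), sliceCLM_apply I (0, 1)] at h
  have h' := (smul_eq_zero.1 h).resolve_left (by norm_num)
  have h4 : I * I = -1 := by rw [← pow_two, hI]
  simp only [Quaternion.coe_one, Quaternion.coe_zero, zero_smul, one_smul, add_zero, zero_add]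
    at h'
  have h5 := congrArg (fun x => I * x) h'
  simp only [mul_add, ← mul_assoc, h4, neg_mul, one_mul, mul_zero] at h5
  exact (add_neg_eq_zero.1 h5).symm

/-! ### Rigidity of lifts -/

/-- The unit is the normalized imaginary part. A real quaternion lies on every slice, so any unit
will do. -/
theorem exists_mem_slice (q : ℍ[ℝ]) : ∃ I : ℍ[ℝ], I ^ 2 = -1 ∧ ∃ p : ℝ × ℝ, sliceCLM I p = q := by
  by_cases h : q.im = 0
  · refine ⟨((Complex.I : ℂ) : ℍ[ℝ]), ?_, (q.re, 0), ?_⟩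
    · rw [← Quaternion.coe_ofComplex, ← map_pow, Complex.I_sq, map_neg, map_one]
    · rw [sliceCLM_apply]
      conv_rhs => rw [← Quaternion.re_add_im q, h]
      simp
  · have hn : ‖q.im‖ ≠ 0 := norm_ne_zero_iff.2 h
    refine ⟨‖q.im‖⁻¹ • q.im, ?_, (q.re, ‖q.im‖), ?_⟩
    · rw [smul_pow, Quaternion.im_sq, Quaternion.normSq_eq_norm_mul_self, smul_neg,
        ← Quaternion.coe_smul, smul_eq_mul]
      rw [show ‖q.im‖⁻¹ ^ 2 * (‖q.im‖ * ‖q.im‖) = 1 by field_simp]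
      simp
    · rw [sliceCLM_apply, smul_smul, mul_inv_cancel₀ hn, one_smul, Quaternion.re_add_im]

/-- The complex functional, linear for the left multiplication by `I`, with a given real part. -/
def complexify (I : ℍ[ℝ]) (lam : ℍ[ℝ] →L[ℝ] ℝ) : ℍ[ℝ] →L[ℝ] ℂ :=
  Complex.ofRealCLM.comp lam -
    (Complex.I • Complex.ofRealCLM).comp (lam.comp (ContinuousLinearMap.mul ℝ ℍ[ℝ] I))

theorem complexify_apply (I : ℍ[ℝ]) (lam : ℍ[ℝ] →L[ℝ] ℝ) (q : ℍ[ℝ]) :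
    complexify I lam q = lam q - Complex.I * lam (I * q) := by
  simp [complexify]

theorem complexify_mul {I : ℍ[ℝ]} (hI : I ^ 2 = -1) (lam : ℍ[ℝ] →L[ℝ] ℝ) (q : ℍ[ℝ]) :
    complexify I lam (I * q) = Complex.I * complexify I lam q := by
  rw [complexify_apply, complexify_apply, ← mul_assoc, ← pow_two, hI]
  simp only [neg_mul, one_mul, map_neg, Complex.ofReal_neg]
  linear_combination (lam (I * q) : ℂ) * Complex.I_mul_I

theorem complexify_re (I : ℍ[ℝ]) (lam : ℍ[ℝ] →L[ℝ] ℝ) (q : ℍ[ℝ]) :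
    (complexify I lam q).re = lam q := by
  simp [complexify_apply]

/-- Liouville's theorem on a slice: a bounded derivative along the real axis is constant. -/
theorem fderiv_slice_const {F : ℍ[ℝ] → ℍ[ℝ]} (hF : Differentiable ℝ F) {I : ℍ[ℝ]}
    (hI : I ^ 2 = -1)
    (hCR : ∀ p, fderiv ℝ F (sliceCLM I p) I = I * fderiv ℝ F (sliceCLM I p) 1)
    {C : ℝ} (hC : ∀ q, ‖fderiv ℝ F q 1‖ ≤ C) (p : ℝ × ℝ) :
    fderiv ℝ F (sliceCLM I p) 1 = fderiv ℝ F 0 1 := by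
  -- Real functionals separate quaternions, and each is the real part of a functional that is
  -- complex linear for left multiplication by `I`. This reduces the claim to scalar entire
  -- functions.
  suffices h : ∀ lam : ℍ[ℝ] →L[ℝ] ℝ,
      lam (fderiv ℝ F (sliceCLM I p) 1) = lam (fderiv ℝ F 0 1) by
    refine ext_inner_left ℝ fun x => ?_
    exact h (innerSL ℝ x)
  intro lam
  let s : ℂ →L[ℝ] ℍ[ℝ] := (sliceCLM I).comp (Complex.equivRealProdCLM : ℂ →L[ℝ] ℝ × ℝ)
  let G : ℂ → ℂ := fun z => complexify I lam (F (s z))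
  have hs : ∀ z, s z = sliceCLM I (z.re, z.im) := fun z => rfl
  have hs1 : s 1 = 1 := by simp [hs, sliceCLM_apply]
  have hsI : s Complex.I = I := by simp [hs, sliceCLM_apply]
  have hG : ∀ z, HasFDerivAt G ((complexify I lam).comp ((fderiv ℝ F (s z)).comp s)) z := by
    intro z
    exact (complexify I lam).hasFDerivAt.comp z ((hF (s z)).hasFDerivAt.comp z s.hasFDerivAt)
  have hGd : Differentiable ℂ G := by
    intro z
    rw [differentiableAt_complex_iff_differentiableAt_real]
    refine ⟨(hG z).differentiableAt, ?_⟩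
    rw [(hG z).fderiv]
    simp only [ContinuousLinearMap.comp_apply, hs1, hsI, smul_eq_mul]
    rw [← complexify_mul hI, hs, hCR]
  have hder : ∀ z, deriv G z = complexify I lam (fderiv ℝ F (s z) 1) := by
    intro z
    have h1 := ((hGd z).hasDerivAt.hasFDerivAt.restrictScalars ℝ).unique (hG z)
    have h2 := congrArg (fun T => T 1) h1
    simpa [hs1] using h2
  have hb : Bornology.IsBounded (Set.range (deriv G)) := by
    refine isBounded_iff_forall_norm_le.2 ⟨‖complexify I lam‖ * C, ?_⟩
    rintro _ ⟨z, rfl⟩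
    rw [hder]
    exact (ContinuousLinearMap.le_opNorm _ _).trans
      (mul_le_mul_of_nonneg_left (hC _) (norm_nonneg _))
  -- Liouville is applied to the derivative of `G`, since `G` itself is unbounded in general.
  have h := hGd.deriv.apply_eq_apply_of_bounded hb (Complex.equivRealProdCLM.symm p) 0
  rw [hder, hder, map_zero] at h
  have h' := congrArg Complex.re h
  rw [complexify_re, complexify_re] at h'
  simpa [s] using h'

/-- The lift of a regular map of tori is a right affine map. -/
theorem eq_affine_of_regular {F : ℍ[ℝ] → ℍ[ℝ]} (hF : Differentiable ℝ F)
    (hCR : ∀ I : ℍ[ℝ], I ^ 2 = -1 → ∀ p,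
      fderiv ℝ F (sliceCLM I p) I = I * fderiv ℝ F (sliceCLM I p) 1)
    {C : ℝ} (hC : ∀ q, ‖fderiv ℝ F q 1‖ ≤ C) (q : ℍ[ℝ]) :
    F q = F 0 + q * fderiv ℝ F 0 1 := by
  obtain ⟨I, hI, p, rfl⟩ := exists_mem_slice q
  set a := fderiv ℝ F 0 1 with ha
  let R : ℍ[ℝ] →L[ℝ] ℍ[ℝ] := (ContinuousLinearMap.mul ℝ ℍ[ℝ]).flip a
  have hd : ∀ p, HasFDerivAt (fun p => F (sliceCLM I p) - R (sliceCLM I p))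
      ((fderiv ℝ F (sliceCLM I p)).comp (sliceCLM I) - R.comp (sliceCLM I)) p := fun p =>
    ((hF _).hasFDerivAt.comp p (sliceCLM I).hasFDerivAt).sub
      (R.hasFDerivAt.comp p (sliceCLM I).hasFDerivAt)
  have hz : ∀ p, (fderiv ℝ F (sliceCLM I p)).comp (sliceCLM I) - R.comp (sliceCLM I) = 0 := by
    intro p
    have h1 := fderiv_slice_const hF hI (hCR I hI) hC p
    refine ContinuousLinearMap.ext fun w => ?_
    have hw : sliceCLM I w = w.1 • 1 + w.2 • I := by simp [sliceCLM]
    have hR : ∀ x, R x = x * a := fun x => rfl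
    simp only [sub_apply, ContinuousLinearMap.comp_apply, hw, map_add, map_smul, hCR I hI, h1, hR,
      zero_apply]
    rw [← ha, add_mul, smul_mul_assoc, smul_mul_assoc, one_mul, sub_self]
  have hc := is_const_of_fderiv_eq_zero (𝕜 := ℝ) (fun p => (hd p).differentiableAt)
    (fun p => (hd p).fderiv.trans (hz p)) p 0
  simp only [map_zero, sub_zero] at hc
  rw [← hc]
  exact (sub_add_cancel _ _).symm

/-- For fixed `l` the difference `F (q + l) - F q` is continuous in `q` with values in the discrete
group `L₂`, hence constant. -/
theorem lift_add_mem {L₁ L₂ : AddSubgroup ℍ[ℝ]} (hL₂ : IsLattice L₂)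
    {f : ℍ[ℝ] ⧸ L₁ → ℍ[ℝ] ⧸ L₂} {F : ℍ[ℝ] → ℍ[ℝ]} (hF : Continuous F)
    (hFf : ∀ q : ℍ[ℝ], (F q : ℍ[ℝ] ⧸ L₂) = f q) {l : ℍ[ℝ]} (hl : l ∈ L₁) :
    F l - F 0 ∈ L₂ ∧ ∀ q, F (q + l) = F q + (F l - F 0) := by
  have h1 : ∀ q, F (q + l) - F q ∈ L₂ := by
    intro q
    have : ((F q : ℍ[ℝ]) : ℍ[ℝ] ⧸ L₂) = (F (q + l) : ℍ[ℝ]) := by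
      rw [hFf, hFf]
      congr 1
      exact QuotientAddGroup.eq.2 (by simpa using hl)
    rw [sub_eq_neg_add]
    exact QuotientAddGroup.eq.1 this
  have h2 := hL₂.eq_of_continuous (d := fun q => F (q + l) - F q) (by fun_prop) h1
  refine ⟨by simpa using h1 0, fun q => ?_⟩
  have := h2 q 0
  simp only [zero_add] at this
  rw [← this]
  abel

/-- Equivalent tori come from lattices that differ by a right multiplication. -/
theorem EquivalentTori.exists_mul {L₁ L₂ : AddSubgroup ℍ[ℝ]} (hL₁ : IsLattice L₁)
    (hL₂ : IsLattice L₂) (h : EquivalentTori L₁ L₂) :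
    ∃ a : ℍ[ℝ], a ≠ 0 ∧ ∀ q, q ∈ L₁ ↔ q * a ∈ L₂ := by
  obtain ⟨f, hsm, -, hreg, -⟩ := h
  obtain ⟨F, hFc, hFf⟩ := hL₂.exists_lift (L₁ := L₁) hsm.1
  have hF := hsm.contDiff_lift hL₁ hL₂ hFc hFf
  have hFd : Differentiable ℝ F := hF.differentiable (by simp)
  have hper : ∀ l ∈ L₁, ∀ q, fderiv ℝ F (q + l) = fderiv ℝ F q := by
    intro l hl q
    rw [← fderiv_comp_add_right]
    simp_rw [(lift_add_mem hL₂ hFc hFf hl).2]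
    exact fderiv_add_const _
  obtain ⟨C, hC⟩ : ∃ C : ℝ, ∀ q, ‖fderiv ℝ F q 1‖ ≤ C := by
    -- By periodicity a bound on a ball containing representatives of all classes is a global bound.
    obtain ⟨r, hr⟩ := hL₁.exists_bounded_rep
    have hcont : Continuous fun q => fderiv ℝ F q 1 :=
      (hF.continuous_fderiv (by simp)).clm_apply continuous_const
    obtain ⟨C, hC⟩ := (isCompact_closedBall (0 : ℍ[ℝ]) r).exists_bound_of_continuousOn
      hcont.continuousOn
    refine ⟨C, fun q => ?_⟩
    obtain ⟨l, hl, hql⟩ := hr q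
    have h1 := hper l hl (q - l)
    rw [sub_add_cancel] at h1
    rw [h1]
    exact hC _ (by simpa using hql)
  have haff := eq_affine_of_regular hFd
    (fun I hI p => hreg.fderiv_lift hL₁ hL₂ hF hFf hI p) hC
  set a := fderiv ℝ F 0 1
  have hback : ∀ q, q * a ∈ L₂ → q ∈ L₁ := by
    intro q hq
    have h1 : f ((0 : ℍ[ℝ]) : ℍ[ℝ] ⧸ L₁) = f (q : ℍ[ℝ] ⧸ L₁) := by
      rw [← hFf, ← hFf, haff q]
      exact QuotientAddGroup.eq.2 (by simpa using hq)
    simpa using QuotientAddGroup.eq.1 (f.injective h1)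
  refine ⟨a, ?_, fun q => ⟨fun hq => ?_, hback q⟩⟩
  · intro ha
    refine hL₁.ne_top ((AddSubgroup.eq_top_iff' _).2 fun q => hback q ?_)
    rw [ha, mul_zero]
    exact L₂.zero_mem
  · have := (lift_add_mem hL₂ hFc hFf hq).1
    rwa [haff q, add_sub_cancel_left] at this

/-! ### The quadratic form on integer vectors -/

theorem rowForm_eq_sum (S : Matrix (Fin 4) (Fin 4) ℝ) (u w : Fin 4 → ℤ) :
    rowForm S u w = ∑ i, ∑ j, (u i : ℝ) * (S i j * w j) := by
  simp [rowForm, dotProduct, Matrix.mulVec, Finset.mul_sum]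

theorem rowForm_smul_smul (S : Matrix (Fin 4) (Fin 4) ℝ) (a b : ℤ) (u w : Fin 4 → ℤ) :
    rowForm S (a • u) (b • w) = a * b * rowForm S u w := by
  simp only [rowForm_eq_sum, Finset.mul_sum, Pi.smul_apply, smul_eq_mul, Int.cast_mul]
  exact Finset.sum_congr rfl fun i _ => Finset.sum_congr rfl fun j _ => by ring

theorem rowForm_one (S : Matrix (Fin 4) (Fin 4) ℝ) (i j : Fin 4) :
    rowForm S ((1 : Matrix (Fin 4) (Fin 4) ℤ) i) ((1 : Matrix (Fin 4) (Fin 4) ℤ) j) = S i j := by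
  simp [rowForm_eq_sum, Matrix.one_apply]

theorem cast_vecMul (u : Fin 4 → ℤ) (U : Matrix (Fin 4) (Fin 4) ℤ) :
    (fun i => ((u ᵥ* U) i : ℝ)) = (fun i => (u i : ℝ)) ᵥ* U.map (Int.cast : ℤ → ℝ) := by
  ext i
  simp [Matrix.vecMul, dotProduct]

theorem rowForm_conj (S : Matrix (Fin 4) (Fin 4) ℝ) (U : Matrix (Fin 4) (Fin 4) ℤ)
    (u w : Fin 4 → ℤ) :
    rowForm (U.map (Int.cast : ℤ → ℝ) * S * (U.map (Int.cast : ℤ → ℝ))ᵀ) u w =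
      rowForm S (u ᵥ* U) (w ᵥ* U) := by
  unfold rowForm
  rw [cast_vecMul, cast_vecMul, ← Matrix.mulVec_mulVec, ← Matrix.mulVec_mulVec,
    Matrix.mulVec_transpose, Matrix.dotProduct_mulVec _ (U.map _)]

theorem map_intCast_mul (U W : Matrix (Fin 4) (Fin 4) ℤ) :
    (U * W).map (Int.cast : ℤ → ℝ) = U.map (Int.cast : ℤ → ℝ) * W.map (Int.cast : ℤ → ℝ) :=
  Matrix.map_mul (f := Int.castRingHom ℝ)

theorem map_intCast_one : (1 : Matrix (Fin 4) (Fin 4) ℤ).map (Int.cast : ℤ → ℝ) = 1 :=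
  Matrix.map_one _ Int.cast_zero Int.cast_one

/-! ### Reduction outputs -/

/-- The integer vectors among which the `k`-th row of a reduction output minimizes the form. -/
def Admissible (U : Matrix (Fin 4) (Fin 4) ℤ) (k : Fin 4) (u : Fin 4 → ℤ) : Prop :=
  (k = 0 → u ≠ 0) ∧ (k ≠ 0 → Completable U k u)

/-- The `k`-th row of `U` minimizes the form among the admissible vectors. -/
def IsMinRow (S : Matrix (Fin 4) (Fin 4) ℝ) (U : Matrix (Fin 4) (Fin 4) ℤ) (k : Fin 4) : Prop :=
  ∀ u, Admissible U k u → rowForm S (U k) (U k) ≤ rowForm S u u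

theorem isReductionOutput_iff {S : Matrix (Fin 4) (Fin 4) ℝ} {U : Matrix (Fin 4) (Fin 4) ℤ} :
    IsReductionOutput S U ↔ IsUnit U.det ∧ (∀ k, IsMinRow S U k) ∧
      ∀ k : Fin 3, 0 ≤ rowForm S (U k.castSucc) (U k.succ) := by
  constructor
  · intro h
    refine ⟨h.isUnit_det, fun k u hu => ?_, h.sign⟩
    by_cases hk : k = 0
    · subst hk
      exact h.first_min u (hu.1 rfl)
    · exact h.next_min k hk u (hu.2 hk)
  · rintro ⟨h1, h2, h3⟩
    exact ⟨h1, fun u hu => h2 0 u ⟨fun _ => hu, fun h => absurd rfl h⟩,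
      fun k hk u hu => h2 k u ⟨fun h => absurd h hk, fun _ => hu⟩, h3⟩

theorem row_ne_zero {V : Matrix (Fin 4) (Fin 4) ℤ} (hV : IsUnit V.det) (k : Fin 4) : V k ≠ 0 := by
  intro h
  rw [Matrix.det_eq_zero_of_row_eq_zero k fun j => congrFun h j] at hV
  exact not_isUnit_zero hV

theorem admissible_row {V : Matrix (Fin 4) (Fin 4) ℤ} (hV : IsUnit V.det) (k : Fin 4) :
    Admissible V k (V k) :=
  ⟨fun _ => row_ne_zero hV k, fun _ => ⟨V, hV, fun _ _ => rfl, rfl⟩⟩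

/-- Admissibility only depends on the previous rows, and on these only up to sign. -/
theorem Admissible.of_rows {U V : Matrix (Fin 4) (Fin 4) ℤ} {k : Fin 4} {u : Fin 4 → ℤ}
    (h : Admissible U k u) (d : Fin 4 → ℤˣ) (hd : ∀ j < k, V j = (d j : ℤ) • U j) :
    Admissible V k u := by
  refine ⟨h.1, fun hk => ?_⟩
  obtain ⟨W, hW, hWU, hWk⟩ := h.2 hk
  -- Only the rows before `k` change sign; row `k` must remain `u`.
  refine ⟨Matrix.diagonal (fun j => if j < k then (d j : ℤ) else 1) * W, ?_, fun j hj => ?_, ?_⟩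
  · rw [Matrix.det_mul, Matrix.det_diagonal]
    refine IsUnit.mul ?_ hW
    rw [IsUnit.prod_iff]
    intro j _
    split_ifs
    · exact (d j).isUnit
    · exact isUnit_one
  · ext l
    rw [Matrix.diagonal_mul, if_pos hj, hd j hj, hWU j hj]
    rfl
  · ext l
    rw [Matrix.diagonal_mul, if_neg (lt_irrefl k), one_mul, hWk]

theorem IsMinRow.of_rows {S : Matrix (Fin 4) (Fin 4) ℝ} {U V : Matrix (Fin 4) (Fin 4) ℤ}
    {k : Fin 4} (h : IsMinRow S U k) (d : Fin 4 → ℤˣ) (hd : ∀ j ≤ k, V j = (d j : ℤ) • U j) :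
    IsMinRow S V k := by
  intro u hu
  have h1 : Admissible U k u := hu.of_rows d fun j hj => by
    rw [hd j hj.le, smul_smul, ← Units.val_mul, Int.units_mul_self, Units.val_one, one_smul]
  rw [hd k le_rfl, rowForm_smul_smul, ← Int.cast_mul, ← Units.val_mul, Int.units_mul_self]
  simpa using h u h1

/-- The bijection `u ↦ u ᵥ* U` of `ℤ⁴` transports the form, the non-zero vectors and the
completability conditions. -/
theorem IsReductionOutput.mul_right {S : Matrix (Fin 4) (Fin 4) ℝ}
    {U W : Matrix (Fin 4) (Fin 4) ℤ} (hU : IsUnit U.det)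
    (h : IsReductionOutput (U.map (Int.cast : ℤ → ℝ) * S * (U.map (Int.cast : ℤ → ℝ))ᵀ) W) :
    IsReductionOutput S (W * U) := by
  have hrow : ∀ k l, rowForm S ((W * U) k) ((W * U) l) =
      rowForm (U.map (Int.cast : ℤ → ℝ) * S * (U.map (Int.cast : ℤ → ℝ))ᵀ) (W k) (W l) := by
    intro k l
    rw [rowForm_conj, Matrix.mul_apply_eq_vecMul, Matrix.mul_apply_eq_vecMul]
  have hinv : ∀ u : Fin 4 → ℤ, (u ᵥ* U⁻¹) ᵥ* U = u := fun u => by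
    rw [Matrix.vecMul_vecMul, Matrix.nonsing_inv_mul _ hU, Matrix.vecMul_one]
  constructor
  · rw [Matrix.det_mul]
    exact h.isUnit_det.mul hU
  · intro u hu
    have := h.first_min (u ᵥ* U⁻¹) fun h0 => hu (by rw [← hinv u, h0, Matrix.zero_vecMul])
    rwa [rowForm_conj, rowForm_conj, hinv, ← Matrix.mul_apply_eq_vecMul] at this
  · rintro k hk u ⟨V, hV, hVW, hVk⟩
    have := h.next_min k hk (u ᵥ* U⁻¹) ⟨V * U⁻¹, ?_, fun j hj => ?_, ?_⟩
    · rwa [rowForm_conj, rowForm_conj, hinv, ← Matrix.mul_apply_eq_vecMul] at this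
    · rw [Matrix.det_mul]
      exact hV.mul (Matrix.isUnit_nonsing_inv_det _ hU)
    · rw [Matrix.mul_apply_eq_vecMul, hVW j hj, ← Matrix.mul_apply_eq_vecMul, mul_assoc,
        Matrix.mul_nonsing_inv _ hU, mul_one]
    · rw [Matrix.mul_apply_eq_vecMul, hVk]
  · intro k
    rw [hrow]
    exact h.sign k

theorem isReductionOutput_mul_iff {S : Matrix (Fin 4) (Fin 4) ℝ}
    {U W : Matrix (Fin 4) (Fin 4) ℤ} (hU : IsUnit U.det) :
    IsReductionOutput S (W * U) ↔
      IsReductionOutput (U.map (Int.cast : ℤ → ℝ) * S * (U.map (Int.cast : ℤ → ℝ))ᵀ) W := by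
  refine ⟨fun h => ?_, IsReductionOutput.mul_right hU⟩
  have h1 : U⁻¹.map (Int.cast : ℤ → ℝ) * U.map (Int.cast : ℤ → ℝ) = 1 := by
    rw [← map_intCast_mul, Matrix.nonsing_inv_mul _ hU, map_intCast_one]
  have h2 : W * U * U⁻¹ = W := by rw [mul_assoc, Matrix.mul_nonsing_inv _ hU, mul_one]
  rw [← h2]
  refine IsReductionOutput.mul_right (Matrix.isUnit_nonsing_inv_det _ hU) ?_
  convert h using 1
  have h3 : (U.map (Int.cast : ℤ → ℝ))ᵀ * (U⁻¹.map (Int.cast : ℤ → ℝ))ᵀ = 1 := by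
    rw [← Matrix.transpose_mul, h1, Matrix.transpose_one]
  rw [Matrix.mul_assoc, Matrix.mul_assoc, Matrix.mul_assoc, h3, mul_one, ← mul_assoc, h1, one_mul]

/-! ### Change of basis -/

/-- The family with coordinates the rows of `V` in the family `v`. -/
def changeBasis (V : Matrix (Fin 4) (Fin 4) ℤ) (v : Fin 4 → ℍ[ℝ]) : Fin 4 → ℍ[ℝ] :=
  fun i => ∑ j, V i j • v j

theorem changeBasis_mul (V W : Matrix (Fin 4) (Fin 4) ℤ) (v : Fin 4 → ℍ[ℝ]) :
    changeBasis (V * W) v = changeBasis V (changeBasis W v) := by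
  funext i
  simp only [changeBasis, Matrix.mul_apply, Finset.sum_smul, Finset.smul_sum, smul_smul]
  exact Finset.sum_comm

theorem changeBasis_one (v : Fin 4 → ℍ[ℝ]) : changeBasis 1 v = v := by
  funext i
  simp [changeBasis, Matrix.one_apply]

theorem changeBasis_neg_one (v : Fin 4 → ℍ[ℝ]) : changeBasis (-1) v = -v := by
  funext i
  simp [changeBasis, Matrix.one_apply]

theorem changeBasis_injective {v : Fin 4 → ℍ[ℝ]} (hv : LinearIndependent ℝ v)
    {V W : Matrix (Fin 4) (Fin 4) ℤ} (h : changeBasis V v = changeBasis W v) : V = W := by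
  ext i j
  have h1 := congrFun h i
  have h2 : ∑ j, ((V i j : ℝ) - (W i j : ℝ)) • v j = 0 := by
    simp only [sub_smul, Finset.sum_sub_distrib, Int.cast_smul_eq_zsmul]
    exact sub_eq_zero.2 h1
  have h3 := Fintype.linearIndependent_iff.1 hv _ h2 j
  exact_mod_cast sub_eq_zero.1 h3

theorem gramMatrix_changeBasis (V : Matrix (Fin 4) (Fin 4) ℤ) (v : Fin 4 → ℍ[ℝ]) :
    (gramMatrix (changeBasis V v)).1 =
      V.map (Int.cast : ℤ → ℝ) * (gramMatrix v).1 * (V.map (Int.cast : ℤ → ℝ))ᵀ := by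
  ext i j
  have h : ∀ i, changeBasis V v i = ∑ k, (V i k : ℝ) • v k := fun i => by
    simp only [changeBasis, Int.cast_smul_eq_zsmul]
  simp only [gramMatrix, Matrix.of_apply, Matrix.mul_apply, Matrix.transpose_apply,
    Matrix.map_apply, h, Finset.sum_mul]
  rw [inner_sum]
  refine Finset.sum_congr rfl fun l _ => ?_
  rw [sum_inner]
  refine Finset.sum_congr rfl fun k _ => ?_
  rw [real_inner_smul_left, real_inner_smul_right]
  ring

theorem gramMatrix_posDef {v : Fin 4 → ℍ[ℝ]} (hv : LinearIndependent ℝ v) :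
    (gramMatrix v).1.PosDef :=
  Matrix.posDef_gram_of_linearIndependent hv

theorem posDef_conj {S : Matrix (Fin 4) (Fin 4) ℝ} (hS : S.PosDef)
    {V : Matrix (Fin 4) (Fin 4) ℤ} (hV : IsUnit V.det) :
    (V.map (Int.cast : ℤ → ℝ) * S * (V.map (Int.cast : ℤ → ℝ))ᵀ).PosDef := by
  have h : Function.Injective (V.map (Int.cast : ℤ → ℝ)).vecMul := by
    refine Function.LeftInverse.injective (g := fun x => x ᵥ* V⁻¹.map (Int.cast : ℤ → ℝ)) ?_
    intro x
    simp only [Matrix.vecMul_vecMul]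
    rw [← map_intCast_mul, Matrix.mul_nonsing_inv _ hV, map_intCast_one, Matrix.vecMul_one]
  simpa [Matrix.conjTranspose_eq_transpose_of_trivial] using hS.mul_mul_conjTranspose_same h

theorem changeBasis_mem {v : Fin 4 → ℍ[ℝ]} {L : AddSubgroup ℍ[ℝ]} (hv : ∀ i, v i ∈ L)
    (V : Matrix (Fin 4) (Fin 4) ℤ) (i : Fin 4) : changeBasis V v i ∈ L :=
  L.sum_mem fun j _ => L.zsmul_mem (hv j) _

theorem IsLatticeBasis.mem {v : Fin 4 → ℍ[ℝ]} {L : AddSubgroup ℍ[ℝ]} (hv : IsLatticeBasis v L)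
    (i : Fin 4) : v i ∈ L :=
  hv.2.le (AddSubgroup.subset_closure ⟨i, rfl⟩)

theorem IsLatticeBasis.changeBasis {v : Fin 4 → ℍ[ℝ]} {L : AddSubgroup ℍ[ℝ]}
    (hv : IsLatticeBasis v L) {V : Matrix (Fin 4) (Fin 4) ℤ} (hV : IsUnit V.det) :
    IsLatticeBasis (changeBasis V v) L := by
  constructor
  · apply Matrix.linearIndependent_of_posDef_gram
    have h := posDef_conj (gramMatrix_posDef hv.1) hV
    rw [← gramMatrix_changeBasis] at h
    exact h
  · apply le_antisymm
    · rw [AddSubgroup.closure_le]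
      rintro _ ⟨i, rfl⟩
      exact changeBasis_mem hv.mem V i
    · rw [← hv.2, AddSubgroup.closure_le]
      rintro _ ⟨i, rfl⟩
      have h : v = QTorus.changeBasis V⁻¹ (QTorus.changeBasis V v) := by
        rw [← changeBasis_mul, Matrix.nonsing_inv_mul _ hV, changeBasis_one]
      rw [congrFun h i]
      exact changeBasis_mem (fun i => AddSubgroup.subset_closure (Set.mem_range_self i)) _ i

theorem IsLatticeBasis.exists_matrix {v : Fin 4 → ℍ[ℝ]} {L : AddSubgroup ℍ[ℝ]}
    (hv : IsLatticeBasis v L) {w : Fin 4 → ℍ[ℝ]} (hw : ∀ i, w i ∈ L) :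
    ∃ V : Matrix (Fin 4) (Fin 4) ℤ, QTorus.changeBasis V v = w := by
  have h : ∀ i, ∃ c : Fin 4 → ℤ, ∑ j, c j • v j = w i := by
    intro i
    have h1 : w i ∈ Submodule.span ℤ (Set.range v) := by
      rw [← Submodule.mem_toAddSubgroup, Submodule.span_int_eq_addSubgroupClosure, hv.2]
      exact hw i
    exact (Submodule.mem_span_range_iff_exists_fun ℤ).1 h1
  choose c hc using h
  exact ⟨Matrix.of c, funext hc⟩

theorem IsLatticeBasis.exists_unimodular {v w : Fin 4 → ℍ[ℝ]} {L : AddSubgroup ℍ[ℝ]}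
    (hv : IsLatticeBasis v L) (hw : IsLatticeBasis w L) :
    ∃ V : Matrix (Fin 4) (Fin 4) ℤ, IsUnit V.det ∧ QTorus.changeBasis V v = w := by
  obtain ⟨V, hV⟩ := hv.exists_matrix hw.mem
  obtain ⟨W, hW⟩ := hw.exists_matrix hv.mem
  refine ⟨V, ?_, hV⟩
  have h : W * V = 1 := changeBasis_injective hv.1 (by
    rw [changeBasis_mul, hV, hW, changeBasis_one])
  exact Matrix.isUnit_det_of_left_inverse h

/-! ### Reduced Gram matrices -/

open scoped MatrixOrder in
/-- A positive definite symmetric matrix is the Gram matrix of a basis. -/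
theorem exists_gramMatrix_eq {R : SymMat} (hR : R.1.PosDef) :
    ∃ v : Fin 4 → ℍ[ℝ], LinearIndependent ℝ v ∧ gramMatrix v = R := by
  let e : OrthonormalBasis (Fin 4) ℝ ℍ[ℝ] :=
    (stdOrthonormalBasis ℝ ℍ[ℝ]).reindex (finCongr Quaternion.finrank_eq_four)
  set B := CFC.sqrt R.1
  have hB : B * B = R.1 := CFC.sqrt_mul_sqrt_self R.1 (Matrix.nonneg_iff_posSemidef.2 hR.posSemidef)
  have hBs : Bᵀ = B := by
    have : IsSelfAdjoint B := (CFC.sqrt_nonneg R.1).isSelfAdjoint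
    rw [← Matrix.conjTranspose_eq_transpose_of_trivial]
    exact this
  let v : Fin 4 → ℍ[ℝ] := fun i => e.repr.symm (WithLp.toLp 2 (B i))
  have hv : gramMatrix v = R := by
    apply Subtype.ext
    ext i j
    rw [← hB]
    simp only [gramMatrix, Matrix.of_apply, v, LinearIsometryEquiv.inner_map_map,
      Matrix.mul_apply, PiLp.inner_apply]
    refine Finset.sum_congr rfl fun k _ => ?_
    have : B k j = B j k := congrFun (congrFun hBs j) k
    rw [this]
    simp [mul_comm]
  refine ⟨v, Matrix.linearIndependent_of_posDef_gram ?_, hv⟩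
  have : (gramMatrix v).1.PosDef := by rw [hv]; exact hR
  exact this

/-- Conjugating `S₀` by an output `U` turns `U` into the trivial output, so membership can be tested
on `R` alone. -/
theorem mem_reducedGram_iff {R : SymMat} :
    R ∈ reducedGram ↔ R.1.PosDef ∧ IsReductionOutput R.1 1 := by
  constructor
  · rintro ⟨v, U, hv, hU, hR⟩
    rw [hR]
    refine ⟨posDef_conj (gramMatrix_posDef hv) hU.isUnit_det, ?_⟩
    rw [← isReductionOutput_mul_iff hU.isUnit_det, one_mul]
    exact hU
  · rintro ⟨h1, h2⟩
    obtain ⟨v, hv, rfl⟩ := exists_gramMatrix_eq h1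
    exact ⟨v, 1, hv, h2, by simp⟩

theorem IsReducedBasis.changeBasis {v : Fin 4 → ℍ[ℝ]} {L : AddSubgroup ℍ[ℝ]}
    (hv : IsLatticeBasis v L) {V : Matrix (Fin 4) (Fin 4) ℤ}
    (hV : IsReductionOutput (gramMatrix v).1 V) : IsReducedBasis (changeBasis V v) L :=
  ⟨hv.changeBasis hV.isUnit_det, v, V, hv.1, hV, gramMatrix_changeBasis V v⟩

/-- The reduced bases are the outputs of the reduction algorithm. -/
theorem IsReducedBasis.exists_output {v w : Fin 4 → ℍ[ℝ]} {L : AddSubgroup ℍ[ℝ]}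
    (hv : IsLatticeBasis v L) (hw : IsReducedBasis w L) :
    ∃ V : Matrix (Fin 4) (Fin 4) ℤ, IsReductionOutput (gramMatrix v).1 V ∧
      QTorus.changeBasis V v = w := by
  obtain ⟨V, hV, rfl⟩ := hv.exists_unimodular hw.1
  refine ⟨V, ?_, rfl⟩
  have h := (mem_reducedGram_iff.1 hw.2).2
  rw [gramMatrix_changeBasis, ← isReductionOutput_mul_iff hV, one_mul] at h
  exact h

/-- Right multiplication by `a` is a similarity of ratio `‖a‖`. -/
theorem gramMatrix_mul_right (v : Fin 4 → ℍ[ℝ]) (a : ℍ[ℝ]) :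
    (gramMatrix fun i => v i * a).1 = (‖a‖ * ‖a‖) • (gramMatrix v).1 := by
  ext i j
  simp only [gramMatrix, Matrix.of_apply, Matrix.smul_apply, smul_eq_mul]
  rw [Quaternion.inner_def, Quaternion.inner_def, star_mul, mul_assoc, ← mul_assoc a,
    Quaternion.self_mul_star, Quaternion.normSq_eq_norm_mul_self, ← mul_assoc,
    ← Quaternion.coe_commutes, mul_assoc, Quaternion.coe_mul_eq_smul, Quaternion.re_smul,
    smul_eq_mul]

theorem rowForm_smul (c : ℝ) (S : Matrix (Fin 4) (Fin 4) ℝ) (u w : Fin 4 → ℤ) :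
    rowForm (c • S) u w = c * rowForm S u w := by
  simp [rowForm, Matrix.smul_mulVec, dotProduct_smul]

theorem IsReductionOutput.smul {S : Matrix (Fin 4) (Fin 4) ℝ} {U : Matrix (Fin 4) (Fin 4) ℤ}
    (h : IsReductionOutput S U) {c : ℝ} (hc : 0 ≤ c) : IsReductionOutput (c • S) U where
  isUnit_det := h.isUnit_det
  first_min u hu := by
    rw [rowForm_smul, rowForm_smul]
    exact mul_le_mul_of_nonneg_left (h.first_min u hu) hc
  next_min k hk u hu := by
    rw [rowForm_smul, rowForm_smul]
    exact mul_le_mul_of_nonneg_left (h.next_min k hk u hu) hc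
  sign k := by
    rw [rowForm_smul]
    exact mul_nonneg hc (h.sign k)

/-- Right multiplication by a non-zero quaternion carries reduced bases to reduced bases. -/
theorem IsReducedBasis.mul_right {v : Fin 4 → ℍ[ℝ]} {L₁ L₂ : AddSubgroup ℍ[ℝ]}
    (hv : IsReducedBasis v L₁) {a : ℍ[ℝ]} (ha : a ≠ 0) (haL : ∀ q, q ∈ L₁ ↔ q * a ∈ L₂) :
    IsReducedBasis (fun i => v i * a) L₂ := by
  have hpos : 0 < ‖a‖ * ‖a‖ := by positivity
  obtain ⟨h1, h2⟩ := mem_reducedGram_iff.1 hv.2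
  have hP : (gramMatrix fun i => v i * a).1.PosDef := by
    rw [gramMatrix_mul_right]
    exact h1.smul hpos
  refine ⟨⟨Matrix.linearIndependent_of_posDef_gram hP, ?_⟩, mem_reducedGram_iff.2 ⟨hP, ?_⟩⟩
  · have h3 : Set.range (fun i => v i * a) = AddMonoidHom.mulRight a '' Set.range v := by
      rw [← Set.range_comp]
      rfl
    rw [h3, ← AddMonoidHom.map_closure, hv.1.2]
    ext q
    rw [AddSubgroup.mem_map]
    refine ⟨?_, fun hq => ⟨q * a⁻¹, ?_, ?_⟩⟩
    · rintro ⟨x, hx, rfl⟩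
      exact (haL x).1 hx
    · rw [haL, mul_assoc, inv_mul_cancel₀ ha, mul_one]
      exact hq
    · simp [mul_assoc, inv_mul_cancel₀ ha]
  · rw [gramMatrix_mul_right]
    exact h2.smul hpos.le

/-! ### Strictly reduced matrices -/

/-- All the inequalities of Minkowski-Siegel reduction are strict, up to signs. -/
structure IsStrictlyReduced (R : Matrix (Fin 4) (Fin 4) ℝ) : Prop where
  eq_of_le : ∀ k u, Admissible 1 k u → rowForm R u u ≤ R k k →
    ∃ d : ℤˣ, u = (d : ℤ) • (1 : Matrix (Fin 4) (Fin 4) ℤ) k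
  sign : ∀ k : Fin 3, 0 < R k.castSucc k.succ

theorem exists_perturbation {R : SymMat} (hR : R ∈ interior reducedGram)
    {E : Matrix (Fin 4) (Fin 4) ℝ} (hE : E.IsSymm) :
    ∃ ε : ℝ, 0 < ε ∧ IsReductionOutput (R.1 + ε • E) 1 ∧ IsReductionOutput (R.1 - ε • E) 1 := by
  let g : ℝ → SymMat := fun t => ⟨R.1 + t • E, R.2.add (hE.smul t)⟩
  have hg : Continuous g := Continuous.subtype_mk (by fun_prop) _
  have h0 : g 0 = R := Subtype.ext (by simp [g])
  have h1 : g ⁻¹' interior reducedGram ∈ nhds (0 : ℝ) :=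
    (isOpen_interior.preimage hg).mem_nhds (by simpa [h0] using hR)
  obtain ⟨r, hr, hball⟩ := Metric.mem_nhds_iff.1 h1
  have h2 : ∀ t : ℝ, |t| < r → IsReductionOutput (R.1 + t • E) 1 := fun t ht =>
    (mem_reducedGram_iff.1 (interior_subset (hball (by simpa using ht) : g t ∈ _))).2
  refine ⟨r / 2, by positivity, h2 _ ?_, ?_⟩
  · rw [abs_of_pos (by positivity)]
    linarith
  · rw [sub_eq_add_neg, ← neg_smul]
    refine h2 _ ?_
    rw [abs_neg, abs_of_pos (by positivity)]
    linarith

theorem rowForm_add (S T : Matrix (Fin 4) (Fin 4) ℝ) (u w : Fin 4 → ℤ) :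
    rowForm (S + T) u w = rowForm S u w + rowForm T u w := by
  simp [rowForm, Matrix.add_mulVec]

theorem rowForm_sub (S T : Matrix (Fin 4) (Fin 4) ℝ) (u w : Fin 4 → ℤ) :
    rowForm (S - T) u w = rowForm S u w - rowForm T u w := by
  simp [rowForm, Matrix.sub_mulVec]

theorem rowForm_single_one (j : Fin 4) (u w : Fin 4 → ℤ) :
    rowForm (Matrix.single j j 1) u w = u j * w j := by
  simp [rowForm_eq_sum, Matrix.single_apply, ite_and]

/-- If `u` ties with `eₖ` at `R`, minimality of `eₖ` at both `R ± ε E_jj` forces `u j ^ 2 = (eₖ) j ^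
2` for every `j`, hence `u = ±eₖ`. -/
theorem isStrictlyReduced_of_mem_interior {R : SymMat} (hR : R ∈ interior reducedGram) :
    IsStrictlyReduced R.1 := by
  constructor
  · intro k u hu hle
    have key : ∀ j, u j * u j =
        (1 : Matrix (Fin 4) (Fin 4) ℤ) k j * (1 : Matrix (Fin 4) (Fin 4) ℤ) k j := by
      intro j
      obtain ⟨ε, hε, h1, h2⟩ := exists_perturbation hR
        (E := Matrix.single j j 1) (by simp [Matrix.IsSymm])
      have h1' := (isReductionOutput_iff.1 h1).2.1 k u hu
      have h2' := (isReductionOutput_iff.1 h2).2.1 k u hu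
      rw [rowForm_add, rowForm_add, rowForm_smul, rowForm_smul, rowForm_single_one,
        rowForm_single_one, rowForm_one] at h1'
      rw [rowForm_sub, rowForm_sub, rowForm_smul, rowForm_smul, rowForm_single_one,
        rowForm_single_one, rowForm_one] at h2'
      have h3 := le_of_mul_le_mul_left (by linarith :
        ε * ((u j : ℝ) * u j) ≤ ε * (((1 : Matrix (Fin 4) (Fin 4) ℤ) k j : ℝ) *
          ((1 : Matrix (Fin 4) (Fin 4) ℤ) k j : ℝ))) hε
      have h4 := le_of_mul_le_mul_left (by linarith :
        ε * (((1 : Matrix (Fin 4) (Fin 4) ℤ) k j : ℝ) *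
          ((1 : Matrix (Fin 4) (Fin 4) ℤ) k j : ℝ)) ≤ ε * ((u j : ℝ) * u j)) hε
      exact_mod_cast le_antisymm h3 h4
    have hk : u k * u k = 1 := by simpa using key k
    refine ⟨⟨u k, u k, hk, hk⟩, ?_⟩
    ext j
    by_cases hj : k = j
    · subst hj
      simp
    · have h := key j
      rw [Matrix.one_apply_ne hj, mul_zero, mul_self_eq_zero] at h
      simp [Matrix.one_apply_ne hj, h]
  · intro k
    -- The entry remains non-negative after `ε` is subtracted from it, so it is at least `ε`.
    obtain ⟨ε, hε, -, h2⟩ := exists_perturbation hR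
      (E := Matrix.single k.castSucc k.succ 1 + Matrix.single k.succ k.castSucc 1)
      (by simp [Matrix.IsSymm, add_comm])
    have h := h2.sign k
    rw [rowForm_one] at h
    have hne : k.castSucc ≠ k.succ := (Fin.castSucc_lt_succ).ne
    simp [hne, hne.symm] at h
    linarith

/-- A strictly reduced matrix has only the trivial reductions. -/
theorem IsStrictlyReduced.eq_one_or_neg_one {R : Matrix (Fin 4) (Fin 4) ℝ}
    (hR : IsStrictlyReduced R) {V : Matrix (Fin 4) (Fin 4) ℤ} (hV : IsReductionOutput R V) :
    V = 1 ∨ V = -1 := by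
  obtain ⟨hdet, hmin, hsign⟩ := isReductionOutput_iff.1 hV
  have hrow : ∀ k, ∃ d : ℤˣ, V k = (d : ℤ) • (1 : Matrix (Fin 4) (Fin 4) ℤ) k := by
    intro k
    -- Once the earlier rows are `±eⱼ`, `V` and `1` have the same admissible vectors for row `k`. So
    -- `V k` does no worse than `eₖ`, and strictness applies.
    induction k using WellFoundedLT.induction with
    | ind k ih =>
      choose! d hd using ih
      refine hR.eq_of_le k (V k) ((admissible_row hdet k).of_rows d fun j hj => ?_) ?_
      · rw [hd j hj, smul_smul, ← Units.val_mul, Int.units_mul_self, Units.val_one, one_smul]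
      · rw [← rowForm_one R k k]
        exact hmin k _ ((admissible_row (by simp) k).of_rows d hd)
  choose d hd using hrow
  -- Positive neighbouring products force consecutive signs to agree, so a single sign remains.
  have hdd : ∀ k : Fin 3, d k.castSucc = d k.succ := by
    intro k
    have h := hsign k
    rw [hd, hd, rowForm_smul_smul, rowForm_one] at h
    have h1 := nonneg_of_mul_nonneg_left h (hR.sign k)
    rcases Int.units_eq_one_or (d k.castSucc) with h2 | h2 <;>
      rcases Int.units_eq_one_or (d k.succ) with h3 | h3 <;> rw [h2, h3] at h1 ⊢ <;>
      norm_num at h1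
  have hd0 : ∀ k, d k = d 0 := by
    intro k
    have h0 := hdd 0
    have h1 := hdd 1
    have h2 := hdd 2
    simp at h0 h1 h2
    fin_cases k <;> simp <;> simp_all
  rcases Int.units_eq_one_or (d 0) with h | h
  · left
    ext i j
    rw [hd i, hd0 i, h]
    simp
  · right
    ext i j
    rw [hd i, hd0 i, h]
    simp

/-! ### Coercivity and existence of minima -/

theorem exists_coercive {S : Matrix (Fin 4) (Fin 4) ℝ} (hS : S.PosDef) :
    ∃ c : ℝ, 0 < c ∧ ∀ x : Fin 4 → ℝ, c * ‖x‖ ^ 2 ≤ x ⬝ᵥ (S *ᵥ x) := by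
  have hcont : Continuous fun x : Fin 4 → ℝ => x ⬝ᵥ (S *ᵥ x) := by fun_prop
  obtain ⟨y, hy, hmin⟩ := (isCompact_sphere (0 : Fin 4 → ℝ) 1).exists_isMinOn
    (NormedSpace.sphere_nonempty.2 zero_le_one) hcont.continuousOn
  have hy1 : ‖y‖ = 1 := by simpa using hy
  have hy0 : y ≠ 0 := by
    rintro rfl
    simp at hy1
  refine ⟨y ⬝ᵥ (S *ᵥ y), by simpa using hS.dotProduct_mulVec_pos hy0, fun x => ?_⟩
  by_cases hx : x = 0
  · simp [hx]
  · have hn : 0 < ‖x‖ := norm_pos_iff.2 hx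
    have h : y ⬝ᵥ (S *ᵥ y) ≤ (‖x‖⁻¹ • x) ⬝ᵥ (S *ᵥ (‖x‖⁻¹ • x)) :=
      hmin (by simp [norm_smul, hn.ne'])
    rw [Matrix.mulVec_smul, dotProduct_smul, smul_dotProduct, smul_eq_mul, smul_eq_mul] at h
    calc _ ≤ (‖x‖⁻¹ * (‖x‖⁻¹ * x ⬝ᵥ (S *ᵥ x))) * ‖x‖ ^ 2 := by gcongr
      _ = _ := by field_simp

theorem finite_norm_sq_le {c : ℝ} (hc : 0 < c) (M : ℝ) :
    {u : Fin 4 → ℤ | c * ‖fun i => (u i : ℝ)‖ ^ 2 ≤ M}.Finite := by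
  obtain ⟨N, hN⟩ := exists_nat_ge (M / c)
  refine (Set.finite_Icc (fun _ : Fin 4 => -(N : ℤ)) fun _ => (N : ℤ)).subset ?_
  intro u hu
  have h : ∀ i, |u i| ≤ (N : ℤ) := by
    intro i
    have h1 : (|u i| : ℝ) ≤ ‖fun i => (u i : ℝ)‖ := norm_le_pi_norm (fun i => (u i : ℝ)) i
    have h2 : ‖fun i => (u i : ℝ)‖ ^ 2 ≤ M / c := by
      rw [le_div_iff₀ hc, mul_comm]
      exact hu
    have h3 : (|u i| : ℝ) ^ 2 ≤ N := (pow_le_pow_left₀ (abs_nonneg _) h1 2).trans (h2.trans hN)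
    have h4 : |u i| ^ 2 ≤ (N : ℤ) := by exact_mod_cast h3
    nlinarith [abs_nonneg (u i)]
  exact ⟨fun i => (abs_le.1 (h i)).1, fun i => (abs_le.1 (h i)).2⟩

/-- By coercivity only finitely many integer vectors do at least as well as `u₀`. -/
theorem exists_rowForm_min {S : Matrix (Fin 4) (Fin 4) ℝ} (hS : S.PosDef)
    {P : (Fin 4 → ℤ) → Prop} {u₀ : Fin 4 → ℤ} (h₀ : P u₀) :
    ∃ u, P u ∧ ∀ w, P w → rowForm S u u ≤ rowForm S w w := by
  obtain ⟨c, hc, hS'⟩ := exists_coercive hS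
  have hfin : {u : Fin 4 → ℤ | P u ∧ rowForm S u u ≤ rowForm S u₀ u₀}.Finite :=
    (finite_norm_sq_le hc (rowForm S u₀ u₀)).subset fun u hu => (hS' _).trans hu.2
  obtain ⟨u, hu, hmin⟩ := Set.exists_min_image _ (fun u => rowForm S u u) hfin ⟨u₀, h₀, le_rfl⟩
  refine ⟨u, hu.1, fun w hw => ?_⟩
  by_cases h : rowForm S w w ≤ rowForm S u₀ u₀
  · exact hmin w ⟨hw, h⟩
  · exact hu.2.trans (not_le.1 h).le

theorem rowForm_pos {S : Matrix (Fin 4) (Fin 4) ℝ} (hS : S.PosDef) {u : Fin 4 → ℤ} (hu : u ≠ 0) :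
    0 < rowForm S u u := by
  have h : (fun i => (u i : ℝ)) ≠ 0 := fun h => hu (funext fun i => by
    simpa using congrFun h i)
  simpa [rowForm] using hS.dotProduct_mulVec_pos h

/-! ### Completing reductions -/

/-- A primitive integer vector is the first row of a unimodular matrix. -/
theorem exists_unimodular_row_zero {u g : Fin 4 → ℤ} (h : g ⬝ᵥ u = 1) :
    ∃ V : Matrix (Fin 4) (Fin 4) ℤ, IsUnit V.det ∧ V 0 = u := by
  let φ : (Fin 4 → ℤ) →ₗ[ℤ] ℤ :=
    { toFun := fun x => g ⬝ᵥ x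
      map_add' := dotProduct_add g
      map_smul' := fun c x => dotProduct_smul c g x }
  have hφ : φ u = 1 := h
  -- Since `g ⬝ᵥ u = 1`, `ℤ⁴` splits as `ℤ u ⊕ ker φ`; a basis of the kernel completes `u`.
  obtain ⟨n, b⟩ := Submodule.basisOfPid (Pi.basisFun ℤ (Fin 4)) (LinearMap.ker φ)
  let B := Module.Basis.mkFinCons u b
    (fun c x hx hc => by
      have h1 := congrArg φ hc
      rw [map_add, map_smul, hφ, LinearMap.mem_ker.1 hx] at h1
      simpa using h1)
    (fun z => ⟨-φ z, by rw [LinearMap.mem_ker, map_add, map_smul, hφ]; simp⟩)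
  obtain rfl : n = 3 := by
    have h1 := Module.finrank_eq_card_basis B
    have h2 : Module.finrank ℤ (Fin 4 → ℤ) = 4 := by simp
    rw [Fintype.card_fin] at h1
    omega
  refine ⟨Matrix.of fun i => B i, ?_, ?_⟩
  · have h1 := (Pi.basisFun ℤ (Fin 4)).toMatrix_mul_toMatrix_flip B
    have h2 : (Pi.basisFun ℤ (Fin 4)).toMatrix B = (Matrix.of fun i => B i)ᵀ := by
      ext i j
      simp [Module.Basis.toMatrix_apply]
    rw [h2] at h1
    rw [← Matrix.det_transpose]
    exact Matrix.isUnit_det_of_right_inverse h1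
  · change B 0 = u
    simp [B]

/-- A shortest vector is primitive: dividing it by the gcd `d` of its entries divides the form by
`d²`, so `d² = 1`. -/
theorem exists_unimodular_of_min {S : Matrix (Fin 4) (Fin 4) ℝ} (hS : S.PosDef) {u : Fin 4 → ℤ}
    (hu : u ≠ 0) (hmin : ∀ w, w ≠ 0 → rowForm S u u ≤ rowForm S w w) :
    ∃ V : Matrix (Fin 4) (Fin 4) ℤ, IsUnit V.det ∧ V 0 = u := by
  obtain ⟨d, hd⟩ := (IsPrincipalIdealRing.principal (Ideal.span (Set.range u))).principal
  have hdvd : ∀ i, d ∣ u i := by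
    intro i
    have h1 : u i ∈ Ideal.span (Set.range u) := Ideal.subset_span ⟨i, rfl⟩
    rw [hd] at h1
    exact Ideal.mem_span_singleton.1 h1
  choose w hw using hdvd
  have huw : u = d • w := funext hw
  have hd0 : d ≠ 0 := by
    rintro rfl
    exact hu (by simpa using huw)
  have hw0 : w ≠ 0 := by
    rintro rfl
    exact hu (by simpa using huw)
  have h1 := hmin w hw0
  rw [huw, rowForm_smul_smul] at h1
  have h2 : (d : ℝ) * d ≤ 1 := by
    by_contra hlt
    nlinarith [rowForm_pos hS hw0]
  have h3 : d * d ≤ 1 := by exact_mod_cast h2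
  have h4 : d * d = 1 := by
    have := mul_self_pos.2 hd0
    omega
  have h5 : (d : ℤ) ∈ Submodule.span ℤ (Set.range u) := by
    have : d ∈ Ideal.span (Set.range u) := by
      rw [hd]
      exact Submodule.mem_span_singleton_self d
    exact this
  obtain ⟨c, hc⟩ := (Submodule.mem_span_range_iff_exists_fun ℤ).1 h5
  refine exists_unimodular_row_zero (g := d • c) ?_
  rw [smul_dotProduct, smul_eq_mul]
  have : c ⬝ᵥ u = d := by simpa [dotProduct] using hc
  rw [this, h4]

/-- If the first rows of a unimodular matrix are minimal, the other ones can be modified so that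
all rows are minimal. -/
theorem exists_isMinRow_extension {S : Matrix (Fin 4) (Fin 4) ℝ} (hS : S.PosDef)
    {U : Matrix (Fin 4) (Fin 4) ℤ} (hU : IsUnit U.det) {k : Fin 4}
    (hmin : ∀ j ≤ k, IsMinRow S U j) :
    ∃ V : Matrix (Fin 4) (Fin 4) ℤ, IsUnit V.det ∧ (∀ j ≤ k, V j = U j) ∧ ∀ j, IsMinRow S V j := by
  have key : ∀ n : ℕ, k.1 ≤ n → ∃ V : Matrix (Fin 4) (Fin 4) ℤ, IsUnit V.det ∧
      (∀ j ≤ k, V j = U j) ∧ ∀ j : Fin 4, j.1 ≤ n → IsMinRow S V j := by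
    intro n hn
    induction n, hn using Nat.le_induction with
    | base => exact ⟨U, hU, fun _ _ => rfl, hmin⟩
    | succ n hn ih =>
      obtain ⟨V, hV, hVU, hVmin⟩ := ih
      by_cases hn4 : n + 1 < 4
      · let m : Fin 4 := ⟨n + 1, hn4⟩
        have hm0 : m ≠ 0 := by simp [m, Fin.ext_iff]
        -- A minimizing candidate for row `m` comes with its own completion `W`, which replaces `V`;
        -- the later rows are still free.
        obtain ⟨u, ⟨W, hW, hWV, rfl⟩, humin⟩ := exists_rowForm_min hS
          (P := Completable V m) (u₀ := V m) ⟨V, hV, fun _ _ => rfl, rfl⟩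
        have hsame : ∀ j < m, W j = ((1 : ℤˣ) : ℤ) • V j := fun j hj => by simp [hWV j hj]
        refine ⟨W, hW, fun j hj => ?_, fun j hj => ?_⟩
        · rw [hWV j (lt_of_le_of_lt hj (Nat.lt_succ_of_le hn)), hVU j hj]
        · rcases Nat.lt_or_eq_of_le hj with hj | hj
          · exact (hVmin j (Nat.le_of_lt_succ hj)).of_rows (fun _ => 1)
              fun i hi => hsame i (lt_of_le_of_lt hi hj)
          · obtain rfl : j = m := Fin.ext hj
            intro w hw
            refine humin w ((hw.of_rows (V := V) (fun _ => 1) fun i hi => ?_).2 hm0)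
            simp [hsame i hi]
      · exact ⟨V, hV, hVU, fun j hj => hVmin j (by omega)⟩
  obtain ⟨V, h1, h2, h3⟩ := key 4 (by omega)
  exact ⟨V, h1, h2, fun j => h3 j (by omega)⟩

/-- Choosing signs turns a matrix with minimal rows into a reduction output. -/
theorem exists_reductionOutput_of_isMinRow {S : Matrix (Fin 4) (Fin 4) ℝ}
    {V : Matrix (Fin 4) (Fin 4) ℤ} (hV : IsUnit V.det) (hmin : ∀ j, IsMinRow S V j) :
    ∃ W : Matrix (Fin 4) (Fin 4) ℤ, IsReductionOutput S W ∧
      ∃ d : Fin 4 → ℤˣ, ∀ j, W j = (d j : ℤ) • V j := by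
  have hs : ∀ k : Fin 3, ∃ s : ℤˣ, 0 ≤ ((s : ℤ) : ℝ) * rowForm S (V k.castSucc) (V k.succ) := by
    intro k
    rcases le_total 0 (rowForm S (V k.castSucc) (V k.succ)) with h | h
    · exact ⟨1, by simpa using h⟩
    · exact ⟨-1, by simpa using h⟩
  choose s hs using hs
  obtain ⟨d, hd⟩ : ∃ d : Fin 4 → ℤˣ, ∀ k : Fin 3, d k.castSucc * d k.succ = s k := by
    -- Cumulative products: consecutive quotients, equal to products for signs, recover `s`.
    refine ⟨![1, s 0, s 0 * s 1, s 0 * s 1 * s 2], fun k => ?_⟩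
    fin_cases k
    · simp
    · simp [← mul_assoc, Int.units_mul_self]
    · simp only [Fin.reduceFinMk, Fin.reduceCastSucc, Fin.reduceSucc, Matrix.cons_val]
      rw [← mul_assoc, Int.units_mul_self, one_mul]
  have hrow : ∀ j, (Matrix.diagonal (fun j => (d j : ℤ)) * V) j = (d j : ℤ) • V j := fun j => by
    ext l
    simp [Matrix.diagonal_mul]
  refine ⟨Matrix.diagonal (fun j => (d j : ℤ)) * V, isReductionOutput_iff.2 ⟨?_, fun k => ?_,
    fun k => ?_⟩, d, hrow⟩
  · rw [Matrix.det_mul, Matrix.det_diagonal]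
    exact (IsUnit.prod_iff.2 fun j _ => (d j).isUnit).mul hV
  · exact (hmin k).of_rows d fun j _ => hrow j
  · rw [hrow, hrow, rowForm_smul_smul, ← Int.cast_mul, ← Units.val_mul, hd]
    exact hs k

/-- A reduced matrix with only the trivial reductions is strictly reduced. -/
theorem isStrictlyReduced_of_unique {R : Matrix (Fin 4) (Fin 4) ℝ} (hR : R.PosDef)
    (hred : IsReductionOutput R 1) (huniq : ∀ V, IsReductionOutput R V → V = 1 ∨ V = -1) :
    IsStrictlyReduced R := by
  have hmin1 := (isReductionOutput_iff.1 hred).2.1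
  have huniq' : ∀ V, IsReductionOutput R V →
      ∃ d : ℤˣ, V = (d : ℤ) • (1 : Matrix (Fin 4) (Fin 4) ℤ) := by
    intro V hV
    rcases huniq V hV with h | h
    · exact ⟨1, by simp [h]⟩
    · exact ⟨-1, by simp [h]⟩
  constructor
  · intro k u hu hle
    have humin : ∀ w, Admissible 1 k w → rowForm R u u ≤ rowForm R w w := fun w hw =>
      hle.trans (by rw [← rowForm_one R k k]; exact hmin1 k w hw)
    -- For `k = 0` admissibility only says `u ≠ 0`, so completability has to come from minimality.
    obtain ⟨U, hU, hUrow, rfl⟩ : Completable 1 k u := by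
      by_cases hk : k = 0
      · subst hk
        obtain ⟨V, hV, hVu⟩ := exists_unimodular_of_min hR (hu.1 rfl) fun w hw =>
          humin w ⟨fun _ => hw, fun h => absurd rfl h⟩
        exact ⟨V, hV, fun j hj => absurd hj (Fin.not_lt_zero j), hVu⟩
      · exact hu.2 hk
    have hUmin : ∀ j ≤ k, IsMinRow R U j := by
      intro j hj
      rcases hj.lt_or_eq with hj | rfl
      · exact (hmin1 j).of_rows (fun _ => 1) fun i hi => by simp [hUrow i (hi.trans_lt hj)]
      · intro w hw
        exact humin w (hw.of_rows (fun _ => 1) fun i hi => by simp [hUrow i hi])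
    -- The tie `u` in row `k` extends to a full output. By uniqueness that output is `±1`, so `u =
    -- ±eₖ`.
    obtain ⟨V, hV, hVU, hVmin⟩ := exists_isMinRow_extension hR hU hUmin
    obtain ⟨W, hW, d, hd⟩ := exists_reductionOutput_of_isMinRow hV hVmin
    obtain ⟨e, rfl⟩ := huniq' W hW
    refine ⟨d k * e, ?_⟩
    have h := hd k
    rw [hVU k le_rfl] at h
    rw [Units.val_mul, mul_smul]
    change U k = (d k : ℤ) • ((e : ℤ) • (1 : Matrix (Fin 4) (Fin 4) ℤ)) k
    rw [h, smul_smul, ← Units.val_mul, Int.units_mul_self, Units.val_one, one_smul]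
  · intro k
    have h0 := hred.sign k
    rw [rowForm_one] at h0
    refine lt_of_le_of_ne h0 fun h => ?_
    -- If the `k`-th neighbouring product vanished, flipping the basis vectors up to `k` would keep
    -- all sign conditions and give an output other than `±1`.
    let d : Fin 4 → ℤˣ := fun j => if j ≤ k.castSucc then -1 else 1
    have hrow : ∀ j, Matrix.diagonal (fun j => (d j : ℤ)) j =
        (d j : ℤ) • (1 : Matrix (Fin 4) (Fin 4) ℤ) j := fun j => by
      ext l
      by_cases hjl : j = l
      · subst hjl
        simp
      · simp [Matrix.diagonal_apply_ne _ hjl, Matrix.one_apply_ne hjl]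
    have hout : IsReductionOutput R (Matrix.diagonal fun j => (d j : ℤ)) := by
      refine isReductionOutput_iff.2 ⟨?_, fun j => (hmin1 j).of_rows d fun i _ => hrow i,
        fun i => ?_⟩
      · rw [Matrix.det_diagonal]
        exact IsUnit.prod_iff.2 fun j _ => (d j).isUnit
      · rw [hrow, hrow, rowForm_smul_smul, rowForm_one]
        by_cases hik : i = k
        · rw [hik, ← h, mul_zero]
        · have hdi : d i.castSucc = d i.succ := by
            have : i.castSucc ≤ k.castSucc ↔ i.succ ≤ k.castSucc := by
              simp only [Fin.le_def, Fin.val_castSucc, Fin.val_succ]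
              have := Fin.val_ne_of_ne hik
              omega
            simp only [d, this]
          have hi := hred.sign i
          rw [rowForm_one] at hi
          rw [hdi, ← Int.cast_mul, ← Units.val_mul, Int.units_mul_self]
          simpa using hi
    obtain ⟨e, he⟩ := huniq' _ hout
    have h1 := congrFun (congrFun he 0) 0
    have h2 := congrFun (congrFun he 3) 3
    have hk3 : ¬ (3 : Fin 4) ≤ k.castSucc := by
      simp only [Fin.le_def, Fin.val_castSucc]
      have := k.2
      change ¬ 3 ≤ k.1
      omega
    simp [d, hk3] at h1 h2
    omega

/-! ### Openness of strict reducedness -/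

theorem continuous_entry (i j : Fin 4) : Continuous fun R : SymMat => R.1 i j :=
  continuous_subtype_val.matrix_elem i j

theorem continuous_rowForm (u w : Fin 4 → ℤ) : Continuous fun R : SymMat => rowForm R.1 u w := by
  simp only [rowForm_eq_sum]
  exact continuous_finsetSum _ fun i _ => continuous_finsetSum _ fun j _ =>
    continuous_const.mul ((continuous_entry i j).mul continuous_const)

/-- Coercivity holds uniformly near a positive definite matrix. -/
theorem eventually_coercive {R : SymMat} (hR : R.1.PosDef) :
    ∃ c : ℝ, 0 < c ∧ ∀ᶠ T : SymMat in nhds R, ∀ x : Fin 4 → ℝ, c * ‖x‖ ^ 2 ≤ x ⬝ᵥ (T.1 *ᵥ x) := by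
  obtain ⟨c, hc, hcoer⟩ := exists_coercive hR
  refine ⟨c / 2, by positivity, ?_⟩
  -- Sixteen entries, each off by less than `c / 32`, cost at most `c / 2`.
  have h : ∀ᶠ T : SymMat in nhds R, ∀ i j, |T.1 i j - R.1 i j| < c / 32 := by
    rw [Filter.eventually_all]
    intro i
    rw [Filter.eventually_all]
    intro j
    have h1 := (continuous_entry i j).continuousAt (x := R)
    exact (Metric.tendsto_nhds.1 h1 (c / 32) (by positivity)).mono fun T hT => hT
  filter_upwards [h] with T hT x
  have h2 : x ⬝ᵥ (T.1 *ᵥ x) = x ⬝ᵥ (R.1 *ᵥ x) + ∑ i, ∑ j, x i * ((T.1 i j - R.1 i j) * x j) := by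
    simp only [dotProduct, Matrix.mulVec, Finset.mul_sum]
    rw [← Finset.sum_add_distrib]
    refine Finset.sum_congr rfl fun i _ => ?_
    rw [← Finset.sum_add_distrib]
    exact Finset.sum_congr rfl fun j _ => by ring
  have h3 : ∀ i j, -(c / 32 * ‖x‖ ^ 2) ≤ x i * ((T.1 i j - R.1 i j) * x j) := by
    intro i j
    refine (abs_le.1 ?_).1
    have hi : |x i| ≤ ‖x‖ := norm_le_pi_norm x i
    have hj : |x j| ≤ ‖x‖ := norm_le_pi_norm x j
    rw [abs_mul, abs_mul]
    calc |x i| * (|T.1 i j - R.1 i j| * |x j|) ≤ ‖x‖ * (c / 32 * ‖x‖) := by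
          gcongr
          exact (hT i j).le
      _ = c / 32 * ‖x‖ ^ 2 := by ring
  have h4 : -(c / 2 * ‖x‖ ^ 2) ≤ ∑ i, ∑ j, x i * ((T.1 i j - R.1 i j) * x j) := by
    refine le_trans ?_ (Finset.sum_le_sum fun i _ => Finset.sum_le_sum fun j _ => h3 i j)
    simp only [Finset.sum_const, Finset.card_univ, Fintype.card_fin, nsmul_eq_mul]
    push_cast
    linarith
  have h5 := hcoer x
  rw [h2]
  linarith

/-- Uniform coercivity near `R` makes the minimality inequalities automatic outside a finite set of
vectors. The remaining strict ones are open conditions. -/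
theorem IsStrictlyReduced.mem_interior {R : SymMat} (hR : IsStrictlyReduced R.1)
    (hpos : R.1.PosDef) : R ∈ interior reducedGram := by
  obtain ⟨c, hc, hcoer⟩ := eventually_coercive hpos
  have hdiag : ∀ᶠ T : SymMat in nhds R, ∀ k, T.1 k k < R.1 k k + 1 :=
    Filter.eventually_all.2 fun k =>
      (continuous_entry k k).continuousAt.eventually_lt continuousAt_const (lt_add_one _)
  have hsign : ∀ᶠ T : SymMat in nhds R, ∀ k : Fin 3, 0 < T.1 k.castSucc k.succ :=
    Filter.eventually_all.2 fun k =>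
      continuousAt_const.eventually_lt (continuous_entry _ _).continuousAt (hR.sign k)
  have hmin : ∀ᶠ T : SymMat in nhds R, ∀ k,
      ∀ u ∈ {u : Fin 4 → ℤ | c * ‖fun i => (u i : ℝ)‖ ^ 2 ≤ R.1 k k + 1},
        Admissible 1 k u → T.1 k k ≤ rowForm T.1 u u := by
    refine Filter.eventually_all.2 fun k =>
      (Filter.eventually_all_finite (finite_norm_sq_le hc _)).2 fun u _ => ?_
    by_cases hu : Admissible 1 k u
    · by_cases hle : rowForm R.1 u u ≤ R.1 k k
      -- The only ties are `±eₖ`, where equality holds identically in `T`.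
      · obtain ⟨d, rfl⟩ := hR.eq_of_le k u hu hle
        refine Filter.Eventually.of_forall fun T _ => ?_
        rw [rowForm_smul_smul, rowForm_one, ← Int.cast_mul, ← Units.val_mul, Int.units_mul_self]
        simp
      · exact ((continuous_entry k k).continuousAt.eventually_lt
          (continuous_rowForm u u).continuousAt (not_le.1 hle)).mono fun T hT _ => hT.le
    · exact Filter.Eventually.of_forall fun T h => absurd h hu
  rw [mem_interior_iff_mem_nhds]
  filter_upwards [hcoer, hdiag, hsign, hmin] with T h1 h2 h3 h4
  refine mem_reducedGram_iff.2 ⟨Matrix.PosDef.of_dotProduct_mulVec_pos ?_ fun x hx => ?_,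
    isReductionOutput_iff.2 ⟨by simp, fun k u hu => ?_, fun k => ?_⟩⟩
  · rw [Matrix.IsHermitian, Matrix.conjTranspose_eq_transpose_of_trivial]
    exact T.2
  · have hn : 0 < ‖x‖ := norm_pos_iff.2 hx
    rw [star_trivial]
    exact lt_of_lt_of_le (by positivity) (h1 x)
  · rw [rowForm_one]
    by_cases hs : c * ‖fun i => (u i : ℝ)‖ ^ 2 ≤ R.1 k k + 1
    · exact h4 k u hs hu
    · exact ((h2 k).trans (not_le.1 hs)).le.trans (h1 _)
  · rw [rowForm_one]
    exact (h3 k).le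

/-! ### Tame lattices and tori -/

theorem IsReducedBasis.neg {v : Fin 4 → ℍ[ℝ]} {L : AddSubgroup ℍ[ℝ]} (hv : IsReducedBasis v L) :
    IsReducedBasis (-v) L := by
  have hdet : IsUnit (-1 : Matrix (Fin 4) (Fin 4) ℤ).det := by simp [Matrix.det_neg]
  have h := hv.1.changeBasis hdet
  rw [changeBasis_neg_one] at h
  refine ⟨h, ?_⟩
  convert hv.2 using 1
  exact Subtype.ext (by ext i j; simp [gramMatrix])

/-- The reduced bases of a tame lattice agree up to sign. -/
theorem IsTameLattice.eq_or_eq_neg {L : AddSubgroup ℍ[ℝ]} (hL : IsTameLattice L)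
    {v w : Fin 4 → ℍ[ℝ]} (hv : IsReducedBasis v L) (hw : IsReducedBasis w L) :
    w = v ∨ w = -v := by
  obtain ⟨b, hb, hint⟩ := hL
  have hstrict := isStrictlyReduced_of_mem_interior hint
  have key : ∀ x, IsReducedBasis x L → x = b ∨ x = -b := by
    intro x hx
    obtain ⟨V, hV, rfl⟩ := hx.exists_output hb.1
    rcases hstrict.eq_one_or_neg_one hV with rfl | rfl
    · exact Or.inl (changeBasis_one b)
    · exact Or.inr (changeBasis_neg_one b)
  rcases key v hv with rfl | rfl <;> rcases key w hw with rfl | rfl <;> simp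

/-- A lattice whose reduced bases agree up to sign is tame. -/
theorem isTameLattice_of_unique {L : AddSubgroup ℍ[ℝ]} {v : Fin 4 → ℍ[ℝ]}
    (hv : IsReducedBasis v L) (huniq : ∀ w, IsReducedBasis w L → w = v ∨ w = -v) :
    IsTameLattice L := by
  obtain ⟨hpos, hred⟩ := mem_reducedGram_iff.1 hv.2
  refine ⟨v, hv, (isStrictlyReduced_of_unique hpos hred fun V hV => ?_).mem_interior hpos⟩
  rcases huniq _ (IsReducedBasis.changeBasis hv.1 hV) with h | h
  · exact Or.inl (changeBasis_injective hv.1.1 (h.trans (changeBasis_one v).symm))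
  · exact Or.inr (changeBasis_injective hv.1.1 (h.trans (changeBasis_neg_one v).symm))

end

end QTorus


theorem proposition7p4 (L : AddSubgroup ℍ[ℝ]) (hL : QTorus.IsLattice L)
    (v : Fin 4 → ℍ[ℝ]) (hv : QTorus.IsReducedBasis v L) :
    QTorus.IsTameTorus L ↔ {w : Fin 4 → ℍ[ℝ] | QTorus.IsReducedBasis w L} = {v, -v} := by
  constructor
  · rintro ⟨L', hL', hequiv⟩
    obtain ⟨b, hb, -⟩ := id hL'
    obtain ⟨a, ha, haL⟩ := hequiv.exists_mul hL ⟨b, hb.1⟩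
    ext w
    simp only [Set.mem_ofPred_eq, Set.mem_insert_iff, Set.mem_singleton_iff]
    constructor
    · intro hw
      -- Both bases are moved into the tame lattice, compared there, and `a` is cancelled.
      refine (hL'.eq_or_eq_neg (hv.mul_right ha haL) (hw.mul_right ha haL)).imp ?_ ?_
      · exact fun h => funext fun i => mul_right_cancel₀ ha (congrFun h i)
      · intro h
        funext i
        refine mul_right_cancel₀ ha ?_
        rw [Pi.neg_apply, neg_mul]
        exact congrFun h i
    · rintro (rfl | rfl)
      · exact hv
      · exact hv.neg
  · intro h
    refine ⟨L, QTorus.isTameLattice_of_unique hv fun w hw => ?_, QTorus.equivalentTori_refl hL⟩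
    have : w ∈ {w : Fin 4 → ℍ[ℝ] | QTorus.IsReducedBasis w L} := hw
    rw [h] at this
    exact this
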